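/- Let $L\ge 1$ and $\alpha\ge 2$ be integers, let $m_1,m_2,\Omega,\beta>0$ be real, and put $$\overline\gamma=\Omega^2\beta,\qquad \tilde\gamma=\frac{m_1m_2}{\overline\gamma},\qquad \mathcal S_2=\frac1{\Gamma(m_1)\Gamma(m_2)\Gamma(\alpha)}$$ (in the normalization $\Omega=1$, $\overline\gamma$ is just the scale $\beta$). For $i=1,\dots,L$ let $N_{i,1},N_{i,2}$ be (multipath) random variables such that $N_{i,j}^2$ has the gamma density $$\frac{m_j^{m_j}x^{m_j-1}}{\Omega^{m_j}\Gamma(m_j)}e^{-m_jx/\Omega},\qquad x>0,$$ and let $I_i$ be a (shadowing) random variable with the inverse gamma density $\frac{\beta^\alpha}{\Gamma(\alpha)y^{\alpha+1}}e^{-\beta/y}$, $y>0$. Assume that for each $i$ the variables $N_{i,1},N_{i,2},I_1,\dots,I_L$ are mutually independent. Let $s$ be a random index with $I_s=\max_{1\le i\le L}I_i$, and let $$\gamma_{\rm out}=(N_{s,1}N_{s,2})^2\max_{1\le i\le L}I_i$$ be the output SNR of the shadowing-based selection. For $n=(n_1,\dots,n_\alpha)\in\mathbb Z_{\ge0}^\alpha$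 put $$p=p(n)=\alpha+\sum_{j=1}^\alpha (j-1)n_j,\qquad \mathcal B=\mathcal B(n)=L^{-p}\,\frac{L!}{n_1!\cdots n_\alpha!}\prod_{j=1}^\alpha\Big(\frac1{(j-1)!}\Big)^{n_j}.$$ Let $G^{m,n}_{p,q}(z\mid a;b)$ be Meijer's $G$-function, $$G^{m,n}_{p,q}\Big(z\,\Big|\begin{matrix}a_1,\dots,a_p\\ b_1,\dots,b_q\end{matrix}\Big)=\frac1{2\pi i}\int\frac{\prod_{j=1}^m\Gamma(b_j-u)\prod_{j=1}^n\Gamma(1-a_j+u)}{\prod_{j=m+1}^q\Gamma(1-b_j+u)\prod_{j=n+1}^p\Gamma(a_j-u)}\,z^u\,du,$$ the integral being along a vertical line that separates the poles of the $\Gamma(b_j-u)$, $j\le m$ (on its right) from those of the $\Gamma(1-a_j+u)$, $j\le n$ (on its left). Then $\gamma_{\rm out}$ is almost surely positive and has a probability density $f_{\gamma_{\rm out}}$ such that, for all $\gamma>0$, $$f_{\gamma_{\rm out}}(\gamma)=\frac{\mathcal S_2}{\gamma}\sum_{n_1+\cdots+n_\alpha=L-1}\mathcal B\;G^{2,1}_{1,2}\Big(\frac{\tilde\gamma\gamma}{L}\,\Big|\begin{matrix}1-p\\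 m_1,m_2\end{matrix}\Big),$$ and its distribution function satisfies, for all $\gamma>0$, $$F_{\gamma_{\rm out}}(\gamma)=\mathcal S_2\sum_{n_1+\cdots+n_\alpha=L-1}\mathcal B\;G^{2,2}_{2,3}\Big(\frac{\tilde\gamma\gamma}{L}\,\Big|\begin{matrix}1,\,1-p\\ m_1,m_2,0\end{matrix}\Big).$$ Moreover $\gamma_{\rm out}$ is integrable, and the average output SNR is $$\overline\gamma_{\rm out}=\mathbb E[\gamma_{\rm out}]=\int_0^\infty\gamma f_{\gamma_{\rm out}}(\gamma)\,d\gamma=\frac{L\overline\gamma}{\Gamma(\alpha)}\sum_{n_1+\cdots+n_\alpha=L-1}\mathcal B\,\Gamma(p-1).$$ -/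

import Mathlib

open MeasureTheory ProbabilityTheory
open scoped Nat

noncomputable section

/-- The Mellin-Barnes integrand of the Meijer function `G^{m,n}_{p,q}(z | a ; b)`:
`∏_{j ≤ m} Γ(b_j - s) ∏_{j ≤ n} Γ(1 - a_j + s) /
  (∏_{j > m} Γ(1 - b_j + s) ∏_{j > n} Γ(a_j - s)) * z ^ s`.
Mathlib's `Complex.Gamma` is `0` at its poles, so that `(Complex.Gamma w)⁻¹` is the entire
function `1 / Γ(w)` everywhere. -/
def meijerIntegrand (m n : ℕ) {p q : ℕ} (a : Fin p → ℂ) (b : Fin q → ℂ) (z s : ℂ) : ℂ :=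
  (∏ j : Fin q, if (j : ℕ) < m then Complex.Gamma (b j - s)
      else (Complex.Gamma (1 - b j + s))⁻¹) *
    (∏ j : Fin p, if (j : ℕ) < n then Complex.Gamma (1 - a j + s)
      else (Complex.Gamma (a j - s))⁻¹) * z ^ s

/-- The vertical line `Re s = c` separates the poles of `Γ(b_j - s)`, `j ≤ m` (which lie to its
right), from the poles of `Γ(1 - a_j + s)`, `j ≤ n` (which lie to its left). -/
def MeijerSeparates (m n : ℕ) {p q : ℕ} (a : Fin p → ℂ) (b : Fin q → ℂ) (c : ℝ) : Prop :=
  (∀ j : Fin q, (j : ℕ) < m → c < (b j).re) ∧ (∀ j : Fin p, (j : ℕ) < n → (a j).re - 1 < c)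

open Classical in
/-- Meijer's function `G^{m,n}_{p,q}(z | a ; b) = (1 / 2πi) ∫ φ(s) z ^ s ds`, the contour running
from `c - i∞` to `c + i∞` along a vertical line that separates the two families of poles
(so `s = c + i t`, `ds = i dt`; by Cauchy's theorem the choice of `c` is immaterial).
Junk value `0` if no vertical line separates them. -/
def meijerG (m n : ℕ) {p q : ℕ} (a : Fin p → ℂ) (b : Fin q → ℂ) (z : ℂ) : ℂ :=
  if h : ∃ c : ℝ, MeijerSeparates m n a b c then
    (1 / (2 * (Real.pi : ℂ))) *
      ∫ t : ℝ, meijerIntegrand m n a b z ((h.choose : ℂ) + (t : ℂ) * Complex.I)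
  else 0

/-- The density of the inverse gamma law with shape `α` and scale `β`. -/
def invGammaPDFReal (α β y : ℝ) : ℝ :=
  if 0 < y then β ^ α / (Real.Gamma α * y ^ (α + 1)) * Real.exp (-(β / y)) else 0

/-- The inverse gamma law with shape `α` and scale `β`. -/
def invGammaMeasure (α β : ℝ) : Measure ℝ :=
  volume.withDensity fun y => ENNReal.ofReal (invGammaPDFReal α β y)

/-- Output SNR of the shadowing-based selection: squared double-scattering multipath gain of the
selected UAV `s ω`, times the largest shadowing coefficient. -/
def outputSNR {S : Type*} {L : ℕ} (N : Fin L → Fin 2 → S → ℝ) (I : Fin L → S → ℝ)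
    (s : S → Fin L) (ω : S) : ℝ :=
  (N (s ω) 0 ω * N (s ω) 1 ω) ^ 2 * ⨆ i, I i ω

/-- Multi-indices `(n_1, …, n_α)` of natural numbers with `n_1 + ⋯ + n_α = L - 1`
(`Fin α` counts from `0`, so that `n_{j+1}` is `n j`). -/
def multiIndices (α L : ℕ) : Finset (Fin α → ℕ) :=
  Finset.piAntidiag Finset.univ (L - 1)

/-- `p = α + ∑_{j=1}^{α} (j - 1) n_j`. -/
def pExp {α : ℕ} (n : Fin α → ℕ) : ℕ := α + ∑ j : Fin α, (j : ℕ) * n j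

/-- `𝓑 = L^{-p} (L! / (n_1! ⋯ n_α!)) ∏_{j=1}^{α} (1 / (j - 1)!)^{n_j}`. -/
def coefB (L : ℕ) {α : ℕ} (n : Fin α → ℕ) : ℝ :=
  ((L : ℝ) ^ pExp n)⁻¹ * ((L ! : ℝ) / ∏ j : Fin α, ((n j)! : ℝ)) *
    ∏ j : Fin α, (1 / (((j : ℕ)! : ℕ) : ℝ)) ^ n j

/-- `𝓢₂ = 1 / (Γ(m₁) Γ(m₂) Γ(α))`. -/
def coefS (m₁ m₂ α : ℝ) : ℝ := 1 / (Real.Gamma m₁ * Real.Gamma m₂ * Real.Gamma α)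

end

open Set Filter Topology

/-! Selection leaves the multipath gain unbiased. Up to ties, which have probability zero, `s` is
determined by the shadowings, and for each fixed `i` the pair `N i 0`, `N i 1` is independent of all
of them. Splitting over the events `s = i` shows that the output SNR is distributed as a product of
three independent factors: two gamma variables and the maximal shadowing
(`hasLaw_selected_mul_iSup`).

Since `α` is an integer, an inverse gamma variable has distribution function `F(y) = e^{-β/y}
∑_{k<α} (β/y)^k / k!`. The maximum has distribution function `F^L`, with derivative `L F^{L-1} F'`;
the multinomial theorem applied to `F^{L-1}` turns this into a mixture of inverse gamma densities of
shape `p(n)` and scale `Lβ`, with weights `𝓑 Γ(p) / Γ(α)` (`sum_maxWeight_mul_invGammaPDFReal`,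
`map_iSup_eq_maxInvGamma`).

It remains to treat gamma times gamma times inverse gamma. Complex moments of independent positive
factors multiply, so the moment of order `-s` is a constant times `Γ(a₁ - s) Γ(a₂ - s) Γ(p + s)
w^s`. Mellin inversion (`eq_integral_of_hasMellin`) recovers the density as a Mellin-Barnes
integral, which is the Meijer function. For the distribution function the same argument gains a
factor `1/s = Γ(s) / Γ(1 + s)`, whence `G^{2,2}_{2,3}`. The mean is the moment of order one. -/

/-- The complex moment of order `s` of a measure on `ℝ` exists and equals `c`. -/
def HasMellinMoment (ρ : Measure ℝ) (s c : ℂ) : Prop :=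
  Integrable (fun y : ℝ => (y : ℂ) ^ s) ρ ∧ ∫ y : ℝ, (y : ℂ) ^ s ∂ρ = c

/-! ### Mellin transforms of the gamma and inverse gamma densities -/

theorem HasMellin.congr_Ioi {f g : ℝ → ℂ} {s c : ℂ} (h : HasMellin f s c)
    (hfg : ∀ x > 0, g x = f x) : HasMellin g s c := by
  have hE : EqOn (fun t : ℝ => (t : ℂ) ^ (s - 1) • g t) (fun t : ℝ => (t : ℂ) ^ (s - 1) • f t)
      (Ioi 0) := fun t ht => by simp only [hfg t ht]
  refine ⟨(integrableOn_congr_fun hE measurableSet_Ioi).2 h.1, ?_⟩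
  rw [← h.2]
  exact setIntegral_congr_fun measurableSet_Ioi hE

theorem hasMellin_exp_neg_mul {s : ℂ} (hs : 0 < s.re) {r : ℝ} (hr : 0 < r) :
    HasMellin (fun t : ℝ => ((Real.exp (-(r * t)) : ℝ) : ℂ)) s ((r : ℂ) ^ (-s) * Complex.Gamma s) := by
  have h : HasMellin (fun t : ℝ => ((Real.exp (-t) : ℝ) : ℂ)) s (Complex.Gamma s) := by
    constructor
    · have := Complex.GammaIntegral_convergent hs
      simpa only [MellinConvergent, smul_eq_mul, mul_comm] using this
    · rw [Complex.Gamma_eq_integral hs, Complex.GammaIntegral_eq_mellin]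
  exact ⟨(MellinConvergent.comp_mul_left hr).2 h.1, by
    rw [mellin_comp_mul_left (fun t : ℝ => ((Real.exp (-t) : ℝ) : ℂ)) s hr, h.2, smul_eq_mul]⟩

/-- The extra factor `u` makes the Mellin transform at `s` equal to the moment of order `s` instead
of `s - 1`. Up to a constant the function is `u^a e^{-ru}`, so its transform is that of the
exponential shifted by `a`. -/
theorem hasMellin_self_mul_gammaPDFReal {a r : ℝ} (hr : 0 < r) {s : ℂ} (hs : -a < s.re) :
    HasMellin (fun u : ℝ => ((u * gammaPDFReal a r u : ℝ) : ℂ)) s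
      ((r : ℂ) ^ (-s) * Complex.Gamma (a + s) / Complex.Gamma a) := by
  have hs' : 0 < (s + a).re := by simp; linarith
  have h := hasMellin_exp_neg_mul hs' hr
  have h1 := MellinConvergent.cpow_smul.2 h.1
  have h2 := hasMellin_const_smul h1 (((r ^ a / Real.Gamma a : ℝ)) : ℂ)
  rw [mellin_cpow_smul, h.2] at h2
  have hr' : (r : ℂ) ≠ 0 := by exact_mod_cast hr.ne'
  convert! h2.congr_Ioi (g := fun u : ℝ => ((u * gammaPDFReal a r u : ℝ) : ℂ)) ?_ using 1
  · rw [smul_eq_mul, neg_add, Complex.cpow_add _ _ hr', Complex.cpow_neg _ (a : ℂ), add_comm s,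
      Complex.ofReal_div, Complex.ofReal_cpow hr.le, Complex.Gamma_ofReal]
    have : (r : ℂ) ^ (a : ℂ) ≠ 0 := by simp [Complex.cpow_eq_zero_iff, hr']
    field_simp
  · intro x hx
    rw [gammaPDFReal, if_pos hx.le, smul_eq_mul, smul_eq_mul, ← Complex.ofReal_cpow hx.le,
      ← Complex.ofReal_mul, ← Complex.ofReal_mul, Real.rpow_sub_one hx.ne']
    congr 1
    field_simp

theorem self_mul_invGammaPDFReal {p b x : ℝ} (hb : 0 < b) (hx : 0 < x) :
    x * invGammaPDFReal p b x = x⁻¹ * gammaPDFReal p b x⁻¹ := by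
  rw [invGammaPDFReal, gammaPDFReal, if_pos hx, if_pos (inv_pos.2 hx).le,
    Real.rpow_sub_one (inv_pos.2 hx).ne', Real.inv_rpow hx.le, Real.rpow_add_one hx.ne',
    div_eq_mul_inv b]
  have := (Real.rpow_pos_of_pos hx p).ne'
  field_simp

/-- Weighted by the variable, the gamma and inverse gamma densities are exchanged by `u ↦ 1/u`,
which replaces `s` by `-s`. -/
theorem hasMellin_self_mul_invGammaPDFReal {p b : ℝ} (hb : 0 < b) {s : ℂ} (hs : s.re < p) :
    HasMellin (fun u : ℝ => ((u * invGammaPDFReal p b u : ℝ) : ℂ)) s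
      ((b : ℂ) ^ s * Complex.Gamma (p - s) / Complex.Gamma p) := by
  have h := hasMellin_self_mul_gammaPDFReal (a := p) hb (s := -s) (by simpa using hs)
  refine HasMellin.congr_Ioi (f := fun u : ℝ => ((u⁻¹ * gammaPDFReal p b u⁻¹ : ℝ) : ℂ)) ⟨?_, ?_⟩
    fun x hx => by rw [self_mul_invGammaPDFReal hb hx]
  · have := (MellinConvergent.comp_rpow (f := fun u : ℝ => ((u * gammaPDFReal p b u : ℝ) : ℂ))
      (s := s) (a := -1) (by norm_num)).2 (by simpa [div_neg] using h.1)
    simpa only [Real.rpow_neg_one] using this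
  · rw [mellin_comp_inv (fun u : ℝ => ((u * gammaPDFReal p b u : ℝ) : ℂ)), h.2, neg_neg,
      sub_eq_add_neg]

/-! ### Complex moments of laws with a density on the positive half-line -/

theorem hasMellinMoment_withDensity {g : ℝ → ℝ} (hg : Measurable g) (hg0 : ∀ x, 0 ≤ g x)
    (hneg : ∀ x < 0, g x = 0) {s c : ℂ}
    (h : HasMellin (fun u : ℝ => ((u * g u : ℝ) : ℂ)) s c) :
    HasMellinMoment (volume.withDensity fun x => ENNReal.ofReal (g x)) s c := by
  have hm : Measurable fun x => ENNReal.ofReal (g x) := hg.ennreal_ofReal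
  have hlt : ∀ᵐ x ∂(volume : Measure ℝ), ENNReal.ofReal (g x) < ⊤ := by simp
  have hind : (fun x : ℝ => (ENNReal.ofReal (g x)).toReal • (x : ℂ) ^ s) =ᵐ[volume]
      (Ioi (0 : ℝ)).indicator fun t : ℝ => (t : ℂ) ^ (s - 1) • ((t * g t : ℝ) : ℂ) := by
    have h0 : ∀ᵐ x : ℝ, x ≠ 0 := by simp [ae_iff]
    filter_upwards [h0] with x hx
    rw [ENNReal.toReal_ofReal (hg0 x)]
    rcases lt_or_gt_of_ne hx with h1 | h1
    · rw [hneg x h1, indicator_of_notMem (by simpa using h1.le), zero_smul]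
    · have hx' : (x : ℂ) ≠ 0 := by exact_mod_cast hx
      rw [indicator_of_mem (by simpa using h1), Complex.cpow_sub _ _ hx', Complex.cpow_one,
        Complex.real_smul, smul_eq_mul, Complex.ofReal_mul]
      field_simp
  constructor
  · rw [integrable_withDensity_iff_integrable_smul' hm hlt, integrable_congr hind]
    exact (integrable_indicator_iff measurableSet_Ioi).2 h.1
  · rw [integral_withDensity_eq_integral_toReal_smul hm hlt, integral_congr_ae hind,
      integral_indicator measurableSet_Ioi, ← h.2]
    rfl

theorem ae_pos_withDensity {g : ℝ → ℝ} (hg : Measurable g) (hneg : ∀ x < 0, g x = 0) :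
    ∀ᵐ x ∂(volume.withDensity fun x => ENNReal.ofReal (g x)), 0 < x := by
  rw [ae_withDensity_iff hg.ennreal_ofReal]
  have h0 : ∀ᵐ x : ℝ, x ≠ 0 := by simp [ae_iff]
  filter_upwards [h0] with x hx h
  by_contra h1
  exact h (by simp [hneg x (lt_of_le_of_ne (not_lt.1 h1) hx)])

theorem measurable_invGammaPDFReal (p b : ℝ) : Measurable (invGammaPDFReal p b) := by
  unfold invGammaPDFReal
  refine Measurable.ite measurableSet_Ioi ?_ measurable_const
  fun_prop

theorem invGammaPDFReal_nonneg {p b : ℝ} (hp : 0 < p) (hb : 0 < b) (x : ℝ) :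
    0 ≤ invGammaPDFReal p b x := by
  unfold invGammaPDFReal
  have := Real.Gamma_pos_of_pos hp
  split_ifs <;> positivity

theorem hasMellinMoment_gammaMeasure {a r : ℝ} (ha : 0 < a) (hr : 0 < r) {s : ℂ}
    (hs : -a < s.re) : HasMellinMoment (gammaMeasure a r) s
      ((r : ℂ) ^ (-s) * Complex.Gamma (a + s) / Complex.Gamma a) :=
  hasMellinMoment_withDensity (measurable_gammaPDFReal a r) (gammaPDFReal_nonneg ha hr)
    (fun x hx => by simp [gammaPDFReal, hx]) (hasMellin_self_mul_gammaPDFReal hr hs)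

theorem ae_pos_gammaMeasure (a r : ℝ) : ∀ᵐ x ∂(gammaMeasure a r), 0 < x :=
  ae_pos_withDensity (measurable_gammaPDFReal a r) (fun x hx => by simp [gammaPDFReal, hx])

theorem hasMellinMoment_invGammaMeasure {p b : ℝ} (hp : 0 < p) (hb : 0 < b) {s : ℂ}
    (hs : s.re < p) : HasMellinMoment (invGammaMeasure p b) s
      ((b : ℂ) ^ s * Complex.Gamma (p - s) / Complex.Gamma p) :=
  hasMellinMoment_withDensity (measurable_invGammaPDFReal p b) (invGammaPDFReal_nonneg hp hb)
    (fun x hx => by simp [invGammaPDFReal, hx.le]) (hasMellin_self_mul_invGammaPDFReal hb hs)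

theorem ae_pos_invGammaMeasure (p b : ℝ) : ∀ᵐ x ∂(invGammaMeasure p b), 0 < x :=
  ae_pos_withDensity (measurable_invGammaPDFReal p b)
    (fun x hx => by simp [invGammaPDFReal, hx.le])

/-- The total mass is the moment of order `0`. -/
theorem isProbabilityMeasure_invGammaMeasure {p b : ℝ} (hp : 0 < p) (hb : 0 < b) :
    IsProbabilityMeasure (invGammaMeasure p b) := by
  obtain ⟨h1, h2⟩ := hasMellinMoment_invGammaMeasure hp hb (s := 0) (by simpa using hp)
  have hG : Complex.Gamma p ≠ 0 := by
    rw [Complex.Gamma_ofReal]; exact_mod_cast (Real.Gamma_pos_of_pos hp).ne'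
  simp only [Complex.cpow_zero, sub_zero, one_mul, div_self hG] at h1 h2
  have hfin : IsFiniteMeasure (invGammaMeasure p b) := by
    simpa [integrable_const_iff] using h1
  simp only [integral_const, mul_one, Complex.real_smul] at h2
  have h3 : (invGammaMeasure p b).real univ = 1 := by exact_mod_cast h2
  constructor
  rw [measureReal_def] at h3
  exact (ENNReal.toReal_eq_one_iff _).1 h3

/-! ### Multiplicative convolution -/

theorem ae_pos_mconv {ρ τ : Measure ℝ} [SFinite ρ] [SFinite τ] (hρ : ∀ᵐ x ∂ρ, 0 < x)
    (hτ : ∀ᵐ x ∂τ, 0 < x) : ∀ᵐ x ∂(ρ ∗ₘ τ), 0 < x := by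
  rw [Measure.mconv, ae_map_iff measurable_mul.aemeasurable measurableSet_Ioi]
  filter_upwards [Measure.quasiMeasurePreserving_fst.ae hρ,
    Measure.quasiMeasurePreserving_snd.ae hτ] with z h1 h2 using mul_pos h1 h2

theorem HasMellinMoment.mconv {ρ τ : Measure ℝ} [SFinite ρ] [SFinite τ]
    (hρ : ∀ᵐ x ∂ρ, 0 < x) {s c d : ℂ} (h1 : HasMellinMoment ρ s c) (h2 : HasMellinMoment τ s d)
    (hτ : ∀ᵐ x ∂τ, 0 < x) : HasMellinMoment (ρ ∗ₘ τ) s (c * d) := by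
  have hm : Measurable fun y : ℝ => (y : ℂ) ^ s := by fun_prop
  have hae : (fun z : ℝ × ℝ => ((z.1 * z.2 : ℝ) : ℂ) ^ s) =ᵐ[ρ.prod τ]
      fun z => (z.1 : ℂ) ^ s * (z.2 : ℂ) ^ s := by
    filter_upwards [Measure.quasiMeasurePreserving_fst.ae hρ,
      Measure.quasiMeasurePreserving_snd.ae hτ] with z h1 h2
    rw [Complex.ofReal_mul, Complex.mul_cpow_ofReal_nonneg h1.le h2.le]
  constructor
  · rw [Measure.mconv, integrable_map_measure hm.aestronglyMeasurable measurable_mul.aemeasurable]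
    exact (integrable_congr hae).2 (h1.1.mul_prod h2.1)
  · rw [Measure.mconv, integral_map measurable_mul.aemeasurable hm.aestronglyMeasurable,
      integral_congr_ae hae, ← h1.2, ← h2.2]
    exact integral_prod_mul (fun y : ℝ => (y : ℂ) ^ s) (fun y : ℝ => (y : ℂ) ^ s)

/-- The Mellin transform of the multiplicative convolution of a function with a measure. -/
theorem HasMellin.integral_div {k : ℝ → ℂ} (hk : Measurable k) {ρ : Measure ℝ} [SFinite ρ]
    (hρ : ∀ᵐ x ∂ρ, 0 < x) {s c d : ℂ} (h1 : HasMellin k s c) (h2 : HasMellinMoment ρ s d) :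
    HasMellin (fun x => ∫ y, k (x / y) ∂ρ) s (c * d) := by
  have hm : Measurable fun z : ℝ × ℝ => (z.2 : ℂ) ^ (s - 1) • k (z.2 / z.1) := by fun_prop
  have hdil : ∀ y : ℝ, 0 < y → HasMellin (fun x => k (x / y)) s ((y : ℂ) ^ s * c) := by
    intro y hy
    have hy' : 0 < y⁻¹ := inv_pos.2 hy
    have e : (fun x => k (x / y)) = fun x => k (y⁻¹ * x) := by
      funext x; rw [div_eq_inv_mul]
    rw [e]
    refine ⟨(MellinConvergent.comp_mul_left hy').2 h1.1, ?_⟩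
    rw [mellin_comp_mul_left _ _ hy', h1.2, smul_eq_mul, Complex.ofReal_inv,
      Complex.inv_cpow _ _ (by rw [Complex.arg_ofReal_of_nonneg hy.le]; exact Real.pi_pos.ne),
      Complex.cpow_neg, inv_inv]
  -- The substitution `x = y u` splits the norm integral into a power of `y` and a constant, so
  -- integrability on the product space reduces to the moment of `ρ`.
  have hnorm : ∀ y : ℝ, 0 < y → ∫ x in Ioi (0:ℝ), ‖(x : ℂ) ^ (s - 1) • k (x / y)‖ =
      ‖(y : ℂ) ^ s‖ * ∫ x in Ioi (0:ℝ), ‖(x : ℂ) ^ (s - 1) • k x‖ := by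
    intro y hy
    have h := integral_comp_mul_left_Ioi (fun x : ℝ => ‖(x : ℂ) ^ (s - 1) • k x‖) 0
      (inv_pos.2 hy)
    rw [mul_zero, inv_inv, smul_eq_mul] at h
    have hyc : (y : ℂ) ≠ 0 := by exact_mod_cast hy.ne'
    have : ‖(y : ℂ) ^ s‖ = ‖(y : ℂ) ^ (s - 1)‖ * y := by
      rw [Complex.norm_cpow_eq_rpow_re_of_pos hy, Complex.norm_cpow_eq_rpow_re_of_pos hy,
        Complex.sub_re, Complex.one_re, Real.rpow_sub_one hy.ne', div_mul_cancel₀ _ hy.ne']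
    rw [this, mul_assoc, ← h, ← integral_const_mul]
    refine setIntegral_congr_fun measurableSet_Ioi fun x hx => ?_
    rw [← norm_mul, smul_eq_mul, smul_eq_mul, ← mul_assoc,
      ← Complex.mul_cpow_ofReal_nonneg hy.le (mul_pos (inv_pos.2 hy) hx).le,
      ← Complex.ofReal_mul, mul_inv_cancel_left₀ hy.ne', div_eq_inv_mul]
  have hint : Integrable (fun z : ℝ × ℝ => (z.2 : ℂ) ^ (s - 1) • k (z.2 / z.1))
      (ρ.prod (volume.restrict (Ioi 0))) := by
    rw [integrable_prod_iff hm.aestronglyMeasurable]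
    refine ⟨hρ.mono fun y hy => (hdil y hy).1, ?_⟩
    refine (h2.1.norm.mul_const (∫ x in Ioi (0:ℝ), ‖(x : ℂ) ^ (s - 1) • k x‖)).congr ?_
    exact hρ.mono fun y hy => (hnorm y hy).symm
  constructor
  · have := hint.integral_prod_right
    simpa only [MellinConvergent, integral_smul] using! this
  · simp only [mellin, ← integral_smul]
    rw [← integral_integral_swap hint, ← h2.2, ← integral_const_mul]
    refine integral_congr_ae (hρ.mono fun y hy => ?_)
    exact (hdil y hy).2.trans (mul_comm _ _)

/-! ### The density of a gamma variable times an independent positive variable -/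

/-- For `a < 1` the density itself blows up at `0`, but `u` times it stays bounded; this gives the
constant bound used for domination and integrability. -/
theorem exists_bound_self_mul_gammaPDFReal {a r : ℝ} (ha : 0 < a) (hr : 0 < r) :
    ∃ C, ∀ u, ‖u * gammaPDFReal a r u‖ ≤ C := by
  have hG := Real.Gamma_pos_of_pos ha
  refine ⟨r ^ a / Real.Gamma a * (a / r) ^ a, fun u => ?_⟩
  rcases le_or_gt u 0 with hu | hu
  · rcases hu.lt_or_eq with hu | rfl
    · rw [gammaPDFReal, if_neg (not_le.2 hu), mul_zero, norm_zero]
      positivity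
    · rw [zero_mul, norm_zero]
      positivity
  rw [Real.norm_of_nonneg (mul_nonneg hu.le (gammaPDFReal_nonneg ha hr u)), gammaPDFReal,
    if_pos hu.le, Real.rpow_sub_one hu.ne']
  -- This is `v ≤ e^v` at `v = ru/a`, raised to the power `a`.
  have h1 : (r * u / a) ^ a ≤ Real.exp (r * u) := by
    calc (r * u / a) ^ a ≤ (Real.exp (r * u / a)) ^ a := by
          gcongr
          linarith [Real.add_one_le_exp (r * u / a)]
      _ = Real.exp (r * u) := by
          rw [← Real.exp_mul, div_mul_cancel₀ _ ha.ne']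
  have h2 : u ^ a * Real.exp (-(r * u)) ≤ (a / r) ^ a := by
    rw [Real.exp_neg, ← div_eq_mul_inv, div_le_iff₀ (Real.exp_pos _)]
    calc u ^ a = (a / r) ^ a * (r * u / a) ^ a := by
          rw [← Real.mul_rpow (by positivity) (by positivity)]
          congr 1
          field_simp
      _ ≤ _ := by gcongr
  calc u * (r ^ a / Real.Gamma a * (u ^ a / u) * Real.exp (-(r * u)))
      = r ^ a / Real.Gamma a * (u ^ a * Real.exp (-(r * u))) := by field_simp
    _ ≤ _ := by gcongr

theorem continuousAt_self_mul_gammaPDFReal (a r : ℝ) {u : ℝ} (hu : 0 < u) :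
    ContinuousAt (fun u => u * gammaPDFReal a r u) u := by
  have h : ContinuousAt (fun u : ℝ => u * (r ^ a / Real.Gamma a * u ^ (a - 1) *
      Real.exp (-(r * u)))) u :=
    continuousAt_id.mul ((continuousAt_const.mul
      (Real.continuousAt_rpow_const _ _ (Or.inl hu.ne'))).mul (by fun_prop))
  refine h.congr ?_
  filter_upwards [lt_mem_nhds hu] with v hv
  rw [gammaPDFReal, if_pos hv.le]

theorem continuousAt_integral_comp_div {k : ℝ → ℂ} (hk : Measurable k) {C : ℝ}
    (hC : ∀ u, ‖k u‖ ≤ C) {ρ : Measure ℝ} [IsFiniteMeasure ρ] (hρ : ∀ᵐ y ∂ρ, 0 < y) {x : ℝ}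
    (hx : ∀ᵐ y ∂ρ, ContinuousAt k (x / y)) :
    ContinuousAt (fun x => ∫ y, k (x / y) ∂ρ) x := by
  refine continuousAt_of_dominated (bound := fun _ => C) (Eventually.of_forall fun z => ?_)
    (Eventually.of_forall fun z => Eventually.of_forall fun y => hC _) (integrable_const _) ?_
  · exact (hk.comp (by fun_prop)).aestronglyMeasurable
  · filter_upwards [hρ, hx] with y hy hxy
    exact ContinuousAt.comp (f := fun x : ℝ => x / y) hxy (by fun_prop)

/-- The density of the product of a gamma variable and an independent variable with law `Q`. -/
noncomputable def gammaMixPDF (a r : ℝ) (Q : Measure ℝ) (x : ℝ) : ℝ :=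
  if 0 < x then x⁻¹ * ∫ y, x / y * gammaPDFReal a r (x / y) ∂Q else 0

theorem measurable_gammaMixPDF (a r : ℝ) (Q : Measure ℝ) [SFinite Q] :
    Measurable (gammaMixPDF a r Q) := by
  refine Measurable.ite measurableSet_Ioi (measurable_inv.mul ?_) measurable_const
  have : StronglyMeasurable fun z : ℝ × ℝ => z.1 / z.2 * gammaPDFReal a r (z.1 / z.2) := by
    refine Measurable.stronglyMeasurable ?_
    fun_prop
  exact this.integral_prod_right.measurable

theorem gammaMixPDF_nonneg {a r : ℝ} (ha : 0 < a) (hr : 0 < r) {Q : Measure ℝ}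
    (hQ : ∀ᵐ y ∂Q, 0 < y) (x : ℝ) : 0 ≤ gammaMixPDF a r Q x := by
  unfold gammaMixPDF
  split_ifs with hx
  · refine mul_nonneg (inv_nonneg.2 hx.le) (integral_nonneg_of_ae ?_)
    filter_upwards [hQ] with y hy
    exact mul_nonneg (div_pos hx hy).le (gammaPDFReal_nonneg ha hr _)
  · exact le_rfl

theorem lintegral_comp_mul_left_gammaMeasure {a r : ℝ} {g : ℝ → ENNReal} (hg : Measurable g)
    {y : ℝ} (hy : 0 < y) : ∫⁻ x, g (y * x) ∂(gammaMeasure a r) =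
      ∫⁻ z, ENNReal.ofReal (y⁻¹ * gammaPDFReal a r (z / y)) * g z := by
  have hm : Measurable (gammaPDF a r) := (measurable_gammaPDFReal a r).ennreal_ofReal
  have hG : Measurable fun z => gammaPDF a r (z / y) * g z := by fun_prop
  rw [gammaMeasure, lintegral_withDensity_eq_lintegral_mul _ hm (by fun_prop)]
  have h1 : ∫⁻ x, (gammaPDF a r * fun x => g (y * x)) x =
      ∫⁻ z, gammaPDF a r (z / y) * g z ∂(Measure.map (y * ·) volume) := by
    rw [lintegral_map hG (by fun_prop)]
    refine lintegral_congr fun x => ?_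
    rw [Pi.mul_apply, mul_div_cancel_left₀ _ hy.ne']
  rw [h1, Real.map_volume_mul_left hy.ne', lintegral_smul_measure, smul_eq_mul,
    ← lintegral_const_mul _ hG]
  refine lintegral_congr fun z => ?_
  rw [abs_of_pos (inv_pos.2 hy), ENNReal.ofReal_mul (inv_pos.2 hy).le, gammaPDF, mul_assoc]

/-- Given the second factor `y`, the product has density `y⁻¹ f(z/y)`; Tonelli then allows averaging
over `y` first. -/
theorem gammaMeasure_mconv {a r : ℝ} (ha : 0 < a) (hr : 0 < r) {Q : Measure ℝ}
    [IsFiniteMeasure Q] (hQ : ∀ᵐ y ∂Q, 0 < y) :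
    gammaMeasure a r ∗ₘ Q =
      volume.withDensity fun x => ENNReal.ofReal (gammaMixPDF a r Q x) := by
  have := isProbabilityMeasure_gammaMeasure ha hr
  ext A hA
  have hind : Measurable (A.indicator (1 : ℝ → ENNReal)) := measurable_one.indicator hA
  rw [Measure.mconv_comm, ← lintegral_indicator_one hA, Measure.lintegral_mconv hind,
    withDensity_apply _ hA, ← lintegral_indicator hA]
  have h1 : ∫⁻ y, ∫⁻ x, A.indicator 1 (y * x) ∂(gammaMeasure a r) ∂Q =
      ∫⁻ y, ∫⁻ z, ENNReal.ofReal (y⁻¹ * gammaPDFReal a r (z / y)) * A.indicator 1 z ∂volume ∂Q :=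
    lintegral_congr_ae (hQ.mono fun y hy => lintegral_comp_mul_left_gammaMeasure hind hy)
  rw [h1, lintegral_lintegral_swap (by fun_prop)]
  have h0 : ∀ᵐ x : ℝ, x ≠ 0 := by simp [ae_iff]
  refine lintegral_congr_ae (h0.mono fun z hz => ?_)
  by_cases hzA : z ∈ A
  swap
  · simp [hzA]
  simp only [indicator_of_mem hzA, Pi.one_apply, mul_one]
  rcases lt_or_gt_of_ne hz with h | h
  · rw [gammaMixPDF, if_neg (not_lt.2 h.le), ENNReal.ofReal_zero, ← lintegral_zero (μ := Q)]
    refine lintegral_congr_ae (hQ.mono fun y hy => ?_)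
    simp [gammaPDFReal, not_le.2 (div_neg_of_neg_of_pos h hy)]
  · obtain ⟨C, hC⟩ := exists_bound_self_mul_gammaPDFReal ha hr
    rw [gammaMixPDF, if_pos h, ← integral_const_mul, ofReal_integral_eq_lintegral_ofReal]
    · refine lintegral_congr_ae (hQ.mono fun y hy => ?_)
      simp only
      congr 1
      field_simp
    · refine (Integrable.of_bound (C := C) ?_ (Eventually.of_forall fun y => hC _)).const_mul _
      exact Measurable.aestronglyMeasurable (by fun_prop)
    · filter_upwards [hQ] with y hy
      exact mul_nonneg (inv_pos.2 h).le
        (mul_nonneg (div_pos h hy).le (gammaPDFReal_nonneg ha hr _))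

/-! ### The Gamma function on vertical lines, and Mellin inversion -/

theorem norm_Gamma_le_of_re_pos {s : ℂ} (hs : 0 < s.re) : ‖Complex.Gamma s‖ ≤ Real.Gamma s.re := by
  rw [Complex.Gamma_eq_integral hs, Real.Gamma_eq_integral hs, Complex.GammaIntegral]
  refine (norm_integral_le_integral_norm _).trans_eq ?_
  refine setIntegral_congr_fun measurableSet_Ioi fun x hx => ?_
  rw [norm_mul, Complex.norm_cpow_eq_rpow_re_of_pos hx, Complex.sub_re, Complex.one_re,
    Complex.norm_real,
    Real.norm_of_nonneg (Real.exp_pos _).le]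

theorem continuous_Gamma_comp {g : ℝ → ℂ} (hg : Continuous g) (hpos : ∀ t, 0 < (g t).re) :
    Continuous fun t => Complex.Gamma (g t) := by
  refine continuous_iff_continuousAt.2 fun t => ContinuousAt.comp (f := g) ?_ hg.continuousAt
  refine (Complex.differentiableAt_Gamma _ fun n h => ?_).continuousAt
  have := hpos t
  rw [h] at this
  simp at this
  linarith [(Nat.cast_nonneg n : (0 : ℝ) ≤ n)]

/-- From `Γ(s) = Γ(s + 2) / (s (s + 1))` and `|s| ≤ |s + 1|`. Quadratic decay is enough for the
contour integrals, so Stirling's formula is not needed. -/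
theorem norm_Gamma_le_div {s : ℂ} (hs : 0 < s.re) :
    ‖Complex.Gamma s‖ ≤ Real.Gamma (s.re + 2) * (Complex.normSq s)⁻¹ := by
  have h0 : s ≠ 0 := fun h => by simp [h] at hs
  have h1 : s + 1 ≠ 0 := fun h => by
    have := congrArg Complex.re h
    simp at this
    linarith
  have e : Complex.Gamma (s + 2) = (s + 1) * (s * Complex.Gamma s) := by
    rw [← Complex.Gamma_add_one s h0, ← Complex.Gamma_add_one _ h1, add_assoc, one_add_one_eq_two]
  have h2 : ‖Complex.Gamma (s + 2)‖ ≤ Real.Gamma (s.re + 2) := by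
    simpa using norm_Gamma_le_of_re_pos (s := s + 2) (by simp; linarith)
  have h3 : ‖s‖ ≤ ‖s + 1‖ := by
    rw [← sq_le_sq₀ (norm_nonneg _) (norm_nonneg _), Complex.sq_norm, Complex.sq_norm,
      Complex.normSq_apply, Complex.normSq_apply]
    simp
    nlinarith
  rw [← div_eq_mul_inv, le_div_iff₀ (Complex.normSq_pos.2 h0), Complex.normSq_eq_norm_sq]
  refine le_trans ?_ h2
  rw [e, norm_mul, norm_mul]
  nlinarith [mul_le_mul_of_nonneg_right h3 (mul_nonneg (norm_nonneg s)
    (norm_nonneg (Complex.Gamma s)))]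

/-- The first factor decays quadratically in `t`; the other two are bounded by their values at the
real part. -/
theorem integrable_Gamma_mul_Gamma_mul_Gamma {a b p c : ℝ} (ha : c < a) (hb : c < b)
    (hp : -p < c) : Integrable fun t : ℝ =>
      Complex.Gamma (a - (c + t * Complex.I)) * Complex.Gamma (b - (c + t * Complex.I)) *
        Complex.Gamma (p + (c + t * Complex.I)) := by
  have ra : ∀ t : ℝ, ((a : ℂ) - (c + t * Complex.I)).re = a - c := fun t => by simp
  have rb : ∀ t : ℝ, ((b : ℂ) - (c + t * Complex.I)).re = b - c := fun t => by simp
  have rp : ∀ t : ℝ, ((p : ℂ) + (c + t * Complex.I)).re = p + c := fun t => by simp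
  have ca := continuous_Gamma_comp (g := fun t : ℝ => (a : ℂ) - (c + t * Complex.I))
    (by fun_prop) fun t => by rw [ra]; linarith
  have cb := continuous_Gamma_comp (g := fun t : ℝ => (b : ℂ) - (c + t * Complex.I))
    (by fun_prop) fun t => by rw [rb]; linarith
  have cp := continuous_Gamma_comp (g := fun t : ℝ => (p : ℂ) + (c + t * Complex.I))
    (by fun_prop) fun t => by rw [rp]; linarith
  have hbase : Integrable fun t : ℝ => Real.Gamma (a - c + 2) * ((a - c) ^ 2 + t ^ 2)⁻¹ := by
    have hac : a - c ≠ 0 := by linarith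
    have := (integrable_inv_one_add_sq.comp_div hac).const_mul (((a - c) ^ 2)⁻¹)
    refine (this.congr (Eventually.of_forall fun t => ?_)).const_mul _
    simp only
    rw [← mul_inv]
    congr 1
    field_simp
  refine ((hbase.mul_const (Real.Gamma (b - c))).mul_const (Real.Gamma (p + c))).mono'
    ((ca.mul cb).mul cp).aestronglyMeasurable (Eventually.of_forall fun t => ?_)
  have na := norm_Gamma_le_div (s := (a : ℂ) - (c + t * Complex.I)) (by rw [ra]; linarith)
  have nb := norm_Gamma_le_of_re_pos (s := (b : ℂ) - (c + t * Complex.I)) (by rw [rb]; linarith)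
  have np := norm_Gamma_le_of_re_pos (s := (p : ℂ) + (c + t * Complex.I)) (by rw [rp]; linarith)
  rw [ra] at na
  rw [rb] at nb
  rw [rp] at np
  have hsq : Complex.normSq ((a : ℂ) - (c + t * Complex.I)) = (a - c) ^ 2 + t ^ 2 := by
    rw [Complex.normSq_apply]; simp; ring
  rw [hsq] at na
  rw [norm_mul, norm_mul]
  have := Real.Gamma_pos_of_pos (show 0 < a - c + 2 by linarith)
  have := Real.Gamma_pos_of_pos (show 0 < b - c by linarith)
  gcongr

/-- Mellin inversion carries `x^{-s}` and the Meijer integral `z^s`, so the transform is prescribed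
on the line of real part `-c` and the sign of `t` is reversed. Continuity at `x` makes the inversion
hold pointwise. -/
theorem eq_integral_of_hasMellin {g : ℝ → ℂ} {H : ℂ → ℂ} {c w : ℝ} {K : ℂ} (hw : 0 < w)
    (h : ∀ t : ℝ, HasMellin g (-(c + t * Complex.I))
      (K * (H (c + t * Complex.I) * (w : ℂ) ^ (c + t * Complex.I))))
    (hH : Integrable fun t : ℝ => H (c + t * Complex.I)) {x : ℝ} (hx : 0 < x)
    (hcont : ContinuousAt g x) :
    g x = K * (1 / (2 * (Real.pi : ℂ)) *
      ∫ t : ℝ, H (c + t * Complex.I) * ((w * x : ℝ) : ℂ) ^ (c + t * Complex.I)) := by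
  have hwc : (w : ℂ) ≠ 0 := by exact_mod_cast hw.ne'
  have h' : ∀ t : ℝ, mellin g (((-c : ℝ) : ℂ) + t * Complex.I) =
      K * (H (c + (-t : ℝ) * Complex.I) * (w : ℂ) ^ (c + (-t : ℝ) * Complex.I)) := fun t => by
    rw [← (h (-t)).2]
    congr 1
    push_cast
    ring
  have h0 := (h 0).1
  have e0 : -((c : ℂ) + (0 : ℝ) * Complex.I) = ((-c : ℝ) : ℂ) := by push_cast; ring
  rw [e0] at h0
  have hvert : Complex.VerticalIntegrable (mellin g) (-c) := by
    unfold Complex.VerticalIntegrable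
    simp_rw [h']
    refine Integrable.const_mul ?_ _
    refine Integrable.comp_neg (f := fun t : ℝ =>
      H (c + t * Complex.I) * (w : ℂ) ^ (c + t * Complex.I)) ?_
    refine hH.mul_bdd (c := w ^ c) ?_ (Eventually.of_forall fun t => ?_)
    · refine Continuous.aestronglyMeasurable ?_
      exact Continuous.const_cpow (by fun_prop) (Or.inl hwc)
    · rw [Complex.norm_cpow_eq_rpow_re_of_pos hw]
      simp
  have hinv := mellinInv_mellin_eq (-c) g hx h0 hvert hcont
  rw [← hinv, mellinInv, ← integral_neg_eq_self]
  simp_rw [h']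
  rw [Complex.real_smul, mul_left_comm, ← integral_const_mul K]
  congr 1
  · push_cast; ring
  · refine integral_congr_ae (Eventually.of_forall fun t => ?_)
    have e1 : -(((-c : ℝ) : ℂ) + ((-t : ℝ) : ℂ) * Complex.I) = c + t * Complex.I := by
      push_cast; ring
    simp only [e1, neg_neg, smul_eq_mul]
    rw [Complex.ofReal_mul, Complex.mul_cpow_ofReal_nonneg hw.le hx.le]
    ring

/-- Since `y ≤ x` means `x / y ≥ 1` for positive `y`, this is the kernel whose convolution with a
law is its distribution function. -/
theorem hasMellin_indicator_Ici {s : ℂ} (hs : s.re < 0) :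
    HasMellin (indicator (Ici (1 : ℝ)) fun _ => (1 : ℂ)) s (-1 / s) := by
  have hs0 : s ≠ 0 := fun h => by simp [h] at hs
  have e : (fun t : ℝ => (t : ℂ) ^ (s - 1) • indicator (Ici (1 : ℝ)) (fun _ => (1 : ℂ)) t) =
      indicator (Ici (1 : ℝ)) fun t : ℝ => (t : ℂ) ^ (s - 1) := by
    funext t
    by_cases ht : t ∈ Ici (1 : ℝ) <;> simp [ht]
  have hsub : Ici (1 : ℝ) ∩ Ioi 0 = Ici 1 := inter_eq_left.2 fun t (ht : 1 ≤ t) => mem_Ioi.2 (by linarith)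
  have hre : (s - 1).re < -1 := by simp; linarith
  constructor
  · rw [MellinConvergent, e, IntegrableOn, integrable_indicator_iff measurableSet_Ici,
      IntegrableOn, Measure.restrict_restrict measurableSet_Ici, hsub, ← IntegrableOn,
      integrableOn_Ici_iff_integrableOn_Ioi]
    exact integrableOn_Ioi_cpow_of_lt hre one_pos
  · rw [mellin, e, integral_indicator measurableSet_Ici,
      Measure.restrict_restrict measurableSet_Ici, hsub, integral_Ici_eq_integral_Ioi,
      integral_Ioi_cpow_of_lt hre one_pos]
    simp

/-! ### Density, distribution function and mean of gamma times gamma times inverse gamma -/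

/-- The law of a product of two gamma variables and an inverse gamma variable, all independent. -/
noncomputable def gammaGammaInvGamma (a₁ r₁ a₂ r₂ p b : ℝ) : Measure ℝ :=
  gammaMeasure a₁ r₁ ∗ₘ (gammaMeasure a₂ r₂ ∗ₘ invGammaMeasure p b)

/-- The density of `gammaGammaInvGamma`. -/
noncomputable def gammaGammaInvGammaPDF (a₁ r₁ a₂ r₂ p b : ℝ) : ℝ → ℝ :=
  gammaMixPDF a₁ r₁ (gammaMeasure a₂ r₂ ∗ₘ invGammaMeasure p b)

/-- The left side is the product of the three moments evaluated at `-s`, unsimplified so as to match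
those lemmas; the scales merge into `r₁ r₂ / b`. -/
theorem moment_eq_cpow_mul {r₁ r₂ b : ℝ} (hr₁ : 0 < r₁) (hr₂ : 0 < r₂) (hb : 0 < b)
    (a₁ a₂ p s : ℂ) :
    (r₁ : ℂ) ^ (-(-s)) * Complex.Gamma (a₁ + -s) / Complex.Gamma a₁ *
      ((r₂ : ℂ) ^ (-(-s)) * Complex.Gamma (a₂ + -s) / Complex.Gamma a₂ *
        ((b : ℂ) ^ (-s) * Complex.Gamma (p - -s) / Complex.Gamma p)) =
      1 / (Complex.Gamma a₁ * Complex.Gamma a₂ * Complex.Gamma p) *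
        (Complex.Gamma (a₁ - s) * Complex.Gamma (a₂ - s) * Complex.Gamma (p + s) *
          ((r₁ * r₂ / b : ℝ) : ℂ) ^ s) := by
  have hw : ((r₁ * r₂ / b : ℝ) : ℂ) ^ s = (r₁ : ℂ) ^ s * (r₂ : ℂ) ^ s * (b : ℂ) ^ (-s) := by
    rw [div_eq_mul_inv, Complex.ofReal_mul, Complex.mul_cpow_ofReal_nonneg (by positivity)
      (by positivity), Complex.ofReal_mul, Complex.mul_cpow_ofReal_nonneg hr₁.le hr₂.le,
      Complex.ofReal_inv, Complex.inv_cpow _ _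
      (by rw [Complex.arg_ofReal_of_nonneg hb.le]; exact Real.pi_pos.ne), Complex.cpow_neg]
  rw [hw, neg_neg, sub_neg_eq_add, ← sub_eq_add_neg, ← sub_eq_add_neg]
  simp only [div_eq_mul_inv, mul_inv]
  ring

section

variable {a₁ r₁ a₂ r₂ p b : ℝ} (ha₁ : 0 < a₁) (hr₁ : 0 < r₁) (ha₂ : 0 < a₂) (hr₂ : 0 < r₂)
  (hp : 0 < p) (hb : 0 < b)

include ha₂ hr₂ hp hb

theorem isProbabilityMeasure_gamma_mconv_invGamma :
    IsProbabilityMeasure (gammaMeasure a₂ r₂ ∗ₘ invGammaMeasure p b) := by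
  have := isProbabilityMeasure_gammaMeasure ha₂ hr₂
  have := isProbabilityMeasure_invGammaMeasure hp hb
  infer_instance

theorem ae_pos_gamma_mconv_invGamma :
    ∀ᵐ y ∂(gammaMeasure a₂ r₂ ∗ₘ invGammaMeasure p b), 0 < y := by
  have := isProbabilityMeasure_gammaMeasure ha₂ hr₂
  have := isProbabilityMeasure_invGammaMeasure hp hb
  exact ae_pos_mconv (ae_pos_gammaMeasure _ _) (ae_pos_invGammaMeasure _ _)

theorem hasMellinMoment_gamma_mconv_invGamma {s : ℂ} (h₂ : -a₂ < s.re) (h₃ : s.re < p) :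
    HasMellinMoment (gammaMeasure a₂ r₂ ∗ₘ invGammaMeasure p b) s
      ((r₂ : ℂ) ^ (-s) * Complex.Gamma (a₂ + s) / Complex.Gamma a₂ *
        ((b : ℂ) ^ s * Complex.Gamma (p - s) / Complex.Gamma p)) := by
  have := isProbabilityMeasure_gammaMeasure ha₂ hr₂
  have := isProbabilityMeasure_invGammaMeasure hp hb
  exact (hasMellinMoment_gammaMeasure ha₂ hr₂ h₂).mconv (ae_pos_gammaMeasure _ _)
    (hasMellinMoment_invGammaMeasure hp hb h₃) (ae_pos_invGammaMeasure _ _)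

theorem measurable_gammaGammaInvGammaPDF :
    Measurable (gammaGammaInvGammaPDF a₁ r₁ a₂ r₂ p b) := by
  have := isProbabilityMeasure_gamma_mconv_invGamma ha₂ hr₂ hp hb
  exact measurable_gammaMixPDF _ _ _

include ha₁ hr₁

theorem isProbabilityMeasure_gammaGammaInvGamma :
    IsProbabilityMeasure (gammaGammaInvGamma a₁ r₁ a₂ r₂ p b) := by
  have := isProbabilityMeasure_gammaMeasure ha₁ hr₁
  have := isProbabilityMeasure_gamma_mconv_invGamma ha₂ hr₂ hp hb
  unfold gammaGammaInvGamma
  infer_instance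

theorem ae_pos_gammaGammaInvGamma : ∀ᵐ y ∂(gammaGammaInvGamma a₁ r₁ a₂ r₂ p b), 0 < y := by
  have := isProbabilityMeasure_gammaMeasure ha₁ hr₁
  have := isProbabilityMeasure_gamma_mconv_invGamma ha₂ hr₂ hp hb
  exact ae_pos_mconv (ae_pos_gammaMeasure _ _) (ae_pos_gamma_mconv_invGamma ha₂ hr₂ hp hb)

theorem hasMellinMoment_gammaGammaInvGamma {s : ℂ} (h₁ : -a₁ < s.re) (h₂ : -a₂ < s.re)
    (h₃ : s.re < p) : HasMellinMoment (gammaGammaInvGamma a₁ r₁ a₂ r₂ p b) s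
      ((r₁ : ℂ) ^ (-s) * Complex.Gamma (a₁ + s) / Complex.Gamma a₁ *
        ((r₂ : ℂ) ^ (-s) * Complex.Gamma (a₂ + s) / Complex.Gamma a₂ *
          ((b : ℂ) ^ s * Complex.Gamma (p - s) / Complex.Gamma p))) := by
  have := isProbabilityMeasure_gammaMeasure ha₁ hr₁
  have := isProbabilityMeasure_gamma_mconv_invGamma ha₂ hr₂ hp hb
  exact (hasMellinMoment_gammaMeasure ha₁ hr₁ h₁).mconv (ae_pos_gammaMeasure _ _)
    (hasMellinMoment_gamma_mconv_invGamma ha₂ hr₂ hp hb h₂ h₃)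
    (ae_pos_gamma_mconv_invGamma ha₂ hr₂ hp hb)

theorem gammaGammaInvGamma_eq_withDensity : gammaGammaInvGamma a₁ r₁ a₂ r₂ p b =
    volume.withDensity fun x => ENNReal.ofReal (gammaGammaInvGammaPDF a₁ r₁ a₂ r₂ p b x) := by
  have := isProbabilityMeasure_gamma_mconv_invGamma ha₂ hr₂ hp hb
  exact gammaMeasure_mconv ha₁ hr₁ (ae_pos_gamma_mconv_invGamma ha₂ hr₂ hp hb)

theorem gammaGammaInvGammaPDF_nonneg (x : ℝ) : 0 ≤ gammaGammaInvGammaPDF a₁ r₁ a₂ r₂ p b x :=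
  gammaMixPDF_nonneg ha₁ hr₁ (ae_pos_gamma_mconv_invGamma ha₂ hr₂ hp hb) x

/-- Here `x` times the density is the convolution of `u ↦ u f(u)`, with `f` the first gamma density,
with the law of the other two factors. The abscissa `c` is the one chosen in `meijerG`; only the
separation inequalities are used. -/
theorem gammaGammaInvGammaPDF_eq_meijerG {x : ℝ} (hx : 0 < x) :
    (gammaGammaInvGammaPDF a₁ r₁ a₂ r₂ p b x : ℂ) =
      1 / (Complex.Gamma a₁ * Complex.Gamma a₂ * Complex.Gamma p) / x *
        meijerG 2 1 ![1 - (p : ℂ)] ![(a₁ : ℂ), (a₂ : ℂ)] ((r₁ * r₂ / b * x : ℝ) : ℂ) := by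
  have := isProbabilityMeasure_gamma_mconv_invGamma ha₂ hr₂ hp hb
  have hQ := ae_pos_gamma_mconv_invGamma ha₂ hr₂ hp hb
  set Q := gammaMeasure a₂ r₂ ∗ₘ invGammaMeasure p b with hQdef
  have hsep : ∃ c : ℝ, MeijerSeparates 2 1 ![1 - (p : ℂ)] ![(a₁ : ℂ), (a₂ : ℂ)] c :=
    ⟨0, by
      refine ⟨fun j _ => ?_, fun j _ => ?_⟩
      · fin_cases j
        · simpa using ha₁
        · simpa using ha₂
      · fin_cases j
        simpa using hp⟩
  rw [meijerG, dif_pos hsep]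
  have hc := hsep.choose_spec
  set c := hsep.choose
  have hc1 : c < a₁ := by simpa using hc.1 0 (by simp)
  have hc2 : c < a₂ := by simpa using hc.1 1 (by simp)
  have hc3 : -p < c := by simpa using hc.2 0 (by simp)
  set k : ℝ → ℂ := fun u => ((u * gammaPDFReal a₁ r₁ u : ℝ) : ℂ) with hk
  have hkm : Measurable k := by fun_prop
  obtain ⟨C, hC⟩ := exists_bound_self_mul_gammaPDFReal ha₁ hr₁
  have key := eq_integral_of_hasMellin (g := fun x => ∫ y, k (x / y) ∂Q)
    (H := fun s => Complex.Gamma (a₁ - s) * Complex.Gamma (a₂ - s) * Complex.Gamma (p + s))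
    (c := c) (w := r₁ * r₂ / b)
    (K := 1 / (Complex.Gamma a₁ * Complex.Gamma a₂ * Complex.Gamma p)) (by positivity)
    (fun t => by
      rw [← moment_eq_cpow_mul hr₁ hr₂ hb]
      exact (hasMellin_self_mul_gammaPDFReal hr₁ (by simpa using hc1)).integral_div hkm hQ
        (hasMellinMoment_gamma_mconv_invGamma ha₂ hr₂ hp hb (by simpa using hc2)
          (by simp; linarith)))
    (integrable_Gamma_mul_Gamma_mul_Gamma hc1 hc2 hc3) hx
    (continuousAt_integral_comp_div hkm (C := C)
      (fun u => by simpa only [hk, Complex.norm_real] using hC u) hQ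
      (hQ.mono fun y hy => (Complex.continuous_ofReal.continuousAt).comp
        (continuousAt_self_mul_gammaPDFReal a₁ r₁ (div_pos hx hy))))
  have hint : ∀ t : ℝ, meijerIntegrand 2 1 ![1 - (p : ℂ)] ![(a₁ : ℂ), (a₂ : ℂ)]
      ((r₁ * r₂ / b * x : ℝ) : ℂ) ((c : ℂ) + t * Complex.I) =
      Complex.Gamma (a₁ - (c + t * Complex.I)) * Complex.Gamma (a₂ - (c + t * Complex.I)) *
        Complex.Gamma (p + (c + t * Complex.I)) *
        ((r₁ * r₂ / b * x : ℝ) : ℂ) ^ ((c : ℂ) + t * Complex.I) := fun t => by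
    simp [meijerIntegrand, Fin.prod_univ_two]
  simp_rw [hint]
  have hl : (gammaGammaInvGammaPDF a₁ r₁ a₂ r₂ p b x : ℂ) = (x : ℂ)⁻¹ * ∫ y, k (x / y) ∂Q := by
    rw [gammaGammaInvGammaPDF, gammaMixPDF, if_pos hx, hk, integral_complex_ofReal,
      Complex.ofReal_mul, Complex.ofReal_inv]
  rw [hl, key]
  ring

/-- The indicator kernel contributes `1/s = Γ(s) / Γ(1 + s)`, which accounts for the additional
parameters `1` and `0`. -/
theorem gammaGammaInvGamma_real_Iic_eq_meijerG {x : ℝ} (hx : 0 < x) :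
    ((gammaGammaInvGamma a₁ r₁ a₂ r₂ p b).real (Iic x) : ℂ) =
      1 / (Complex.Gamma a₁ * Complex.Gamma a₂ * Complex.Gamma p) *
        meijerG 2 2 ![1, 1 - (p : ℂ)] ![(a₁ : ℂ), (a₂ : ℂ), 0]
          ((r₁ * r₂ / b * x : ℝ) : ℂ) := by
  have := isProbabilityMeasure_gammaGammaInvGamma ha₁ hr₁ ha₂ hr₂ hp hb
  have hQ := ae_pos_gammaGammaInvGamma ha₁ hr₁ ha₂ hr₂ hp hb
  set Q := gammaGammaInvGamma a₁ r₁ a₂ r₂ p b with hQdef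
  have hsep : ∃ c : ℝ, MeijerSeparates 2 2 ![1, 1 - (p : ℂ)] ![(a₁ : ℂ), (a₂ : ℂ), 0] c :=
    -- The abscissa must now be positive, to the right of the pole of `Γ(s)` at `0`.
    ⟨min a₁ a₂ / 2, by
      have h0 : 0 < min a₁ a₂ := lt_min ha₁ ha₂
      have h1 := min_le_left a₁ a₂
      have h2 := min_le_right a₁ a₂
      refine ⟨fun j hj => ?_, fun j _ => ?_⟩
      · fin_cases j
        · simp; linarith
        · simp; linarith
        · simp at hj
      · fin_cases j
        · simpa using h0
        · simp; linarith⟩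
  rw [meijerG, dif_pos hsep]
  have hc := hsep.choose_spec
  set c := hsep.choose
  have hc1 : c < a₁ := by simpa using hc.1 0 (by simp)
  have hc2 : c < a₂ := by simpa using hc.1 1 (by simp)
  have hc3 : -p < c := by simpa using hc.2 1 (by simp)
  have hc0 : 0 < c := by simpa using hc.2 0 (by simp)
  have hne : ∀ t : ℝ, (c : ℂ) + t * Complex.I ≠ 0 := fun t h => by
    have := congrArg Complex.re h
    simp at this
    linarith
  set k : ℝ → ℂ := indicator (Ici (1 : ℝ)) fun _ => (1 : ℂ) with hk
  have hkm : Measurable k := measurable_const.indicator measurableSet_Ici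
  -- The kernel jumps where `x / y = 1`; having a density, the law gives no mass to that point.
  have hatom : ∀ᵐ y ∂Q, y ≠ x := by
    rw [hQdef, gammaGammaInvGamma_eq_withDensity ha₁ hr₁ ha₂ hr₂ hp hb]
    refine (withDensity_absolutelyContinuous _ _).ae_le ?_
    exact compl_mem_ae_iff.2 Real.volume_singleton
  have key := eq_integral_of_hasMellin (g := fun x => ∫ y, k (x / y) ∂Q)
    (H := fun s => Complex.Gamma (a₁ - s) * Complex.Gamma (a₂ - s) * Complex.Gamma (p + s) * s⁻¹)
    (c := c) (w := r₁ * r₂ / b)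
    (K := 1 / (Complex.Gamma a₁ * Complex.Gamma a₂ * Complex.Gamma p)) (by positivity)
    (fun t => by
      have h := (hasMellin_indicator_Ici (s := -(c + t * Complex.I)) (by simpa using hc0)).integral_div
        hkm hQ (hasMellinMoment_gammaGammaInvGamma ha₁ hr₁ ha₂ hr₂ hp hb
          (by simpa using hc1) (by simpa using hc2) (by simp; linarith))
      rw [moment_eq_cpow_mul hr₁ hr₂ hb] at h
      convert! h using 1
      rw [neg_div_neg_eq]
      ring)
    ((integrable_Gamma_mul_Gamma_mul_Gamma hc1 hc2 hc3).mul_bdd (c := c⁻¹)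
      (Continuous.inv₀ (by fun_prop) hne).aestronglyMeasurable
      (Eventually.of_forall fun t => by
        rw [norm_inv]
        refine inv_anti₀ hc0 ?_
        refine le_trans ?_ (Complex.re_le_norm _)
        simp)) hx
    (continuousAt_integral_comp_div hkm (C := 1)
      (fun u => by
        rw [hk]
        exact (norm_indicator_le_norm_self _ _).trans (by simp)) hQ
      (by
        filter_upwards [hQ, hatom] with y hy hyx
        rcases lt_or_gt_of_ne hyx with h | h
        · refine (continuousAt_const (y := (1 : ℂ))).congr ?_
          filter_upwards [lt_mem_nhds ((one_lt_div hy).2 h)] with u hu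
          rw [hk, indicator_of_mem (mem_Ici.2 hu.le)]
        · refine (continuousAt_const (y := (0 : ℂ))).congr ?_
          filter_upwards [gt_mem_nhds ((div_lt_one hy).2 h)] with u hu
          rw [hk, indicator_of_notMem (by simpa using hu)]))
  have hint : ∀ t : ℝ, meijerIntegrand 2 2 ![1, 1 - (p : ℂ)] ![(a₁ : ℂ), (a₂ : ℂ), 0]
      ((r₁ * r₂ / b * x : ℝ) : ℂ) ((c : ℂ) + t * Complex.I) =
      Complex.Gamma (a₁ - (c + t * Complex.I)) * Complex.Gamma (a₂ - (c + t * Complex.I)) *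
        Complex.Gamma (p + (c + t * Complex.I)) * ((c : ℂ) + t * Complex.I)⁻¹ *
        ((r₁ * r₂ / b * x : ℝ) : ℂ) ^ ((c : ℂ) + t * Complex.I) := fun t => by
    have hG : Complex.Gamma (c + t * Complex.I) ≠ 0 :=
      Complex.Gamma_ne_zero_of_re_pos (by simpa using hc0)
    have h1 : (Complex.Gamma (1 + (c + t * Complex.I)))⁻¹ * Complex.Gamma (c + t * Complex.I) =
        ((c : ℂ) + t * Complex.I)⁻¹ := by
      rw [add_comm 1, Complex.Gamma_add_one _ (hne t), mul_inv, inv_mul_cancel_right₀ hG]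
    rw [← h1]
    simp [meijerIntegrand, Fin.prod_univ_two, Fin.prod_univ_three, -mul_eq_mul_right_iff]
    ring
  simp_rw [hint]
  rw [← key]
  have hl : ∫ y, k (x / y) ∂Q = ∫ y, indicator (Iic x) (fun _ => (1 : ℂ)) y ∂Q := by
    refine integral_congr_ae (hQ.mono fun y hy => ?_)
    simp only [hk, indicator, mem_Ici, mem_Iic, one_le_div hy]
  rw [hl, integral_indicator measurableSet_Iic]
  simp

theorem integrable_and_integral_gammaGammaInvGamma (hp1 : 1 < p) :
    Integrable (fun x : ℝ => x) (gammaGammaInvGamma a₁ r₁ a₂ r₂ p b) ∧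
      ∫ x, x ∂(gammaGammaInvGamma a₁ r₁ a₂ r₂ p b) =
        a₁ / r₁ * (a₂ / r₂) * (b * Real.Gamma (p - 1) / Real.Gamma p) := by
  obtain ⟨h1, h2⟩ := hasMellinMoment_gammaGammaInvGamma ha₁ hr₁ ha₂ hr₂ hp hb (s := 1)
    (by simp; linarith) (by simp; linarith) (by simpa using hp1)
  simp only [Complex.cpow_one] at h1 h2
  refine ⟨by simpa using h1.re, ?_⟩
  rw [integral_complex_ofReal] at h2
  have e1 : (a₁ : ℂ) ≠ 0 := by exact_mod_cast ha₁.ne'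
  have e2 : (a₂ : ℂ) ≠ 0 := by exact_mod_cast ha₂.ne'
  have g1 := Complex.Gamma_ne_zero_of_re_pos (s := (a₁ : ℂ)) (by simpa using ha₁)
  have g2 := Complex.Gamma_ne_zero_of_re_pos (s := (a₂ : ℂ)) (by simpa using ha₂)
  rw [Complex.Gamma_add_one _ e1, Complex.Gamma_add_one _ e2, Complex.cpow_neg_one,
    Complex.cpow_neg_one, ← mul_assoc (r₁ : ℂ)⁻¹, ← mul_assoc (r₂ : ℂ)⁻¹,
    mul_div_cancel_right₀ _ g1, mul_div_cancel_right₀ _ g2] at h2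
  have e3 : ((p : ℂ) - 1) = ((p - 1 : ℝ) : ℂ) := by push_cast; rfl
  rw [e3, Complex.Gamma_ofReal, Complex.Gamma_ofReal] at h2
  have h3 := Complex.ofReal_injective (h2.trans (by push_cast; rfl :
    _ = ((r₁⁻¹ * a₁ * (r₂⁻¹ * a₂ * (b * Real.Gamma (p - 1) / Real.Gamma p)) : ℝ) : ℂ)))
  rw [h3]
  ring

end

/-! ### The maximum of independent inverse gamma variables -/

theorem withDensity_ofReal_sum_mul {ι : Type*} (t : Finset ι) {w : ι → ℝ} {g : ι → ℝ → ℝ}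
    (hw : ∀ i ∈ t, 0 ≤ w i) (hg : ∀ i ∈ t, Measurable (g i)) (hg0 : ∀ i ∈ t, ∀ x, 0 ≤ g i x) :
    (volume.withDensity fun x => ENNReal.ofReal (∑ i ∈ t, w i * g i x)) =
      ∑ i ∈ t, ENNReal.ofReal (w i) • volume.withDensity fun x => ENNReal.ofReal (g i x) := by
  ext A hA
  rw [withDensity_apply _ hA, Measure.finsetSum_apply]
  simp only [Measure.smul_apply, smul_eq_mul, withDensity_apply _ hA]
  have h : ∀ x, ENNReal.ofReal (∑ i ∈ t, w i * g i x) =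
      ∑ i ∈ t, ENNReal.ofReal (w i) * ENNReal.ofReal (g i x) := fun x => by
    rw [ENNReal.ofReal_sum_of_nonneg fun i hi => mul_nonneg (hw i hi) (hg0 i hi x)]
    exact Finset.sum_congr rfl fun i hi => ENNReal.ofReal_mul (hw i hi)
  simp_rw [h]
  rw [lintegral_finsetSum' _ fun i hi => ((hg i hi).ennreal_ofReal.const_mul _).aemeasurable]
  exact Finset.sum_congr rfl fun i hi => lintegral_const_mul _ (hg i hi).ennreal_ofReal

/-- The right limit at `0` replaces the value `G 0`, which would be wrong in the applications: there
`b / 0 = 0` gives `G 0 = 1`. -/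
theorem withDensity_Iic_eq_of_hasDerivAt {G g : ℝ → ℝ} (hg : Integrable g) (hg0 : ∀ x, 0 ≤ g x)
    (hneg : ∀ x ≤ 0, g x = 0) (hG : ∀ x > 0, HasDerivAt G (g x) x)
    (hlim : Tendsto G (𝓝[>] 0) (𝓝 0)) {x : ℝ} (hx : 0 < x) :
    (volume.withDensity fun y => ENNReal.ofReal (g y)) (Iic x) = ENNReal.ofReal (G x) := by
  rw [withDensity_apply _ measurableSet_Iic, ← ofReal_integral_eq_lintegral_ofReal
    hg.integrableOn (Eventually.of_forall hg0)]
  congr 1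
  have h1 : ∫ y in Iic x, g y = ∫ y in Ioc 0 x, g y := by
    refine (setIntegral_eq_of_subset_of_forall_sdiff_eq_zero measurableSet_Iic Ioc_subset_Iic_self
      fun y hy => hneg y ?_)
    by_contra h
    exact hy.2 ⟨not_le.1 h, hy.1⟩
  rw [h1, ← intervalIntegral.integral_of_le hx.le,
    intervalIntegral.integral_eq_sub_of_hasDerivAt_of_tendsto hx (fun y hy => hG y hy.1)
      hg.intervalIntegrable hlim
      ((hG x hx).continuousAt.tendsto.mono_left nhdsWithin_le_nhds), sub_zero]

/-- The survival function of the Erlang law of shape `n` and rate `1`. -/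
noncomputable def erlangTail (n : ℕ) (u : ℝ) : ℝ :=
  Real.exp (-u) * ∑ k ∈ Finset.range n, u ^ k / (k ! : ℝ)

/-- Differentiating term by term telescopes, leaving only the last term. -/
theorem hasDerivAt_erlangTail (n : ℕ) (u : ℝ) :
    HasDerivAt (erlangTail (n + 1)) (-(Real.exp (-u) * (u ^ n / (n ! : ℝ)))) u := by
  have hexp : HasDerivAt (fun u : ℝ => Real.exp (-u)) (-Real.exp (-u)) u := by
    simpa using (hasDerivAt_neg u).exp
  induction n with
  | zero =>
    have e : erlangTail (0 + 1) = fun u : ℝ => Real.exp (-u) := by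
      funext u; simp [erlangTail]
    rw [e]
    simpa using hexp
  | succ n ih =>
    have e : erlangTail (n + 1 + 1) = fun u : ℝ => erlangTail (n + 1) u +
        Real.exp (-u) * (u ^ (n + 1) / ((n + 1)! : ℝ)) := by
      funext u
      rw [erlangTail, Finset.sum_range_succ, mul_add, erlangTail]
    rw [e]
    convert! ih.add (hexp.mul ((hasDerivAt_pow (n + 1) u).div_const ((n + 1)! : ℝ))) using 1
    have : (n ! : ℝ) ≠ 0 := by exact_mod_cast n.factorial_ne_zero
    rw [Nat.factorial_succ]
    push_cast
    field_simp
    ring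

theorem tendsto_erlangTail (n : ℕ) : Tendsto (erlangTail n) atTop (𝓝 0) := by
  have h : Tendsto (fun u : ℝ => ∑ k ∈ Finset.range n, u ^ k * Real.exp (-u) / (k ! : ℝ)) atTop
      (𝓝 (∑ k ∈ Finset.range n, 0 / (k ! : ℝ))) :=
    tendsto_finsetSum _ fun k _ => (Real.tendsto_pow_mul_exp_neg_atTop_nhds_zero k).div_const _
  simp only [zero_div, Finset.sum_const_zero] at h
  refine h.congr fun u => ?_
  rw [erlangTail, Finset.mul_sum]
  exact Finset.sum_congr rfl fun k _ => by ring

theorem tendsto_erlangTail_div_pow (n : ℕ) {L : ℕ} (hL : L ≠ 0) {b : ℝ} (hb : 0 < b) :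
    Tendsto (fun y => erlangTail n (b / y) ^ L) (𝓝[>] 0) (𝓝 0) := by
  have h1 : Tendsto (fun y : ℝ => b / y) (𝓝[>] 0) atTop := by
    simpa only [div_eq_mul_inv] using tendsto_inv_nhdsGT_zero.const_mul_atTop hb
  simpa [hL] using ((tendsto_erlangTail n).comp h1).pow L

theorem hasDerivAt_erlangTail_div_pow (n L : ℕ) (b : ℝ) {y : ℝ} (hy : 0 < y) :
    HasDerivAt (fun y => erlangTail (n + 1) (b / y) ^ L)
      (L * erlangTail (n + 1) (b / y) ^ (L - 1) *
        (Real.exp (-(b / y)) * ((b / y) ^ n / (n ! : ℝ)) * (b / y ^ 2))) y := by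
  have h1 : HasDerivAt (fun y : ℝ => b / y) (-(b / y ^ 2)) y := by
    simpa [div_eq_mul_inv] using (hasDerivAt_inv hy.ne').const_mul b
  convert! ((hasDerivAt_erlangTail n (b / y)).comp y h1).pow L using 1
  simp only [Function.comp]
  ring

theorem integrable_invGammaPDFReal {p b : ℝ} (hp : 0 < p) (hb : 0 < b) :
    Integrable (invGammaPDFReal p b) := by
  have h := isProbabilityMeasure_invGammaMeasure hp hb
  have h1 := h.measure_univ
  rw [invGammaMeasure, withDensity_apply _ MeasurableSet.univ, Measure.restrict_univ] at h1
  refine ⟨(measurable_invGammaPDFReal p b).aestronglyMeasurable, ?_⟩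
  rw [hasFiniteIntegral_iff_ofReal (Eventually.of_forall (invGammaPDFReal_nonneg hp hb)), h1]
  exact ENNReal.one_lt_top

theorem invGammaPDFReal_natCast (p : ℕ) (b : ℝ) {y : ℝ} (hy : 0 < y) :
    invGammaPDFReal p b y = (b / y) ^ p / (Real.Gamma p * y) * Real.exp (-(b / y)) := by
  rw [invGammaPDFReal, if_pos hy, Real.rpow_natCast, Real.rpow_add_one hy.ne', Real.rpow_natCast,
    div_pow]
  field_simp

/-- The weights of the mixture of inverse gamma laws followed by the maximum. -/
noncomputable def maxWeight (L : ℕ) {α : ℕ} (n : Fin α → ℕ) : ℝ :=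
  coefB L n * Real.Gamma (pExp n) / Real.Gamma α

theorem coefB_nonneg (L : ℕ) {α : ℕ} (n : Fin α → ℕ) : 0 ≤ coefB L n := by
  unfold coefB
  positivity

theorem maxWeight_nonneg (L : ℕ) {α : ℕ} (n : Fin α → ℕ) : 0 ≤ maxWeight L n :=
  div_nonneg (mul_nonneg (coefB_nonneg L n) (Real.Gamma_nonneg_of_nonneg (Nat.cast_nonneg _)))
    (Real.Gamma_nonneg_of_nonneg (Nat.cast_nonneg _))

theorem le_pExp {α : ℕ} (n : Fin α → ℕ) : α ≤ pExp n := Nat.le_add_right _ _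

/-- The right side is the derivative of `F^L`. In the multinomial expansion of the `(L-1)`-th power,
the term of index `n` carries `(b/y)` to the power `∑ j n_j`; the density supplies `α` more powers
up to a factor `1/y`, which gives the shape `p(n)`. -/
theorem sum_maxWeight_mul_invGammaPDFReal {L : ℕ} (hL : L ≠ 0) (k : ℕ) (b : ℝ) {y : ℝ}
    (hy : 0 < y) :
    ∑ n ∈ multiIndices (k + 1) L, maxWeight L n * invGammaPDFReal (pExp n) (L * b) y =
      L * erlangTail (k + 1) (b / y) ^ (L - 1) *
        (Real.exp (-(b / y)) * ((b / y) ^ k / (k ! : ℝ)) * (b / y ^ 2)) := by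
  have hL0 : (L : ℝ) ≠ 0 := by exact_mod_cast hL
  -- `L - 1` exponentials come from the power and one from the density, so the scale becomes `L b`.
  have hexp : Real.exp (-(L * b / y)) = Real.exp (-(b / y)) ^ (L - 1) * Real.exp (-(b / y)) := by
    rw [← pow_succ, Nat.sub_add_cancel (Nat.one_le_iff_ne_zero.2 hL), ← Real.exp_nat_mul]
    congr 1
    ring
  rw [erlangTail, mul_pow, ← Fin.sum_univ_eq_sum_range (fun j => (b / y) ^ j / (j ! : ℝ)),
    Finset.sum_pow_eq_sum_piAntidiag, multiIndices, Finset.mul_sum, Finset.mul_sum,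
    Finset.sum_mul]
  refine Finset.sum_congr rfl fun n hn => ?_
  have hsum : ∑ j, n j = L - 1 := (Finset.mem_piAntidiag.1 hn).1
  have hmult : ((L - 1)! : ℝ) = (∏ j, ((n j)! : ℝ)) * (Nat.multinomial Finset.univ n : ℝ) := by
    rw [← hsum, ← Nat.multinomial_spec]
    push_cast
    rfl
  have hLf : (L ! : ℝ) = L * ((L - 1)! : ℝ) := by
    exact_mod_cast (Nat.mul_factorial_pred hL).symm
  have hprod : ∏ j : Fin (k + 1), ((b / y) ^ (j : ℕ) / ((j : ℕ)! : ℝ)) ^ n j =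
      (b / y) ^ (∑ j : Fin (k + 1), (j : ℕ) * n j) *
        ∏ j : Fin (k + 1), (1 / (((j : ℕ)! : ℕ) : ℝ)) ^ n j := by
    rw [← Finset.prod_pow_eq_pow_sum, ← Finset.prod_mul_distrib]
    refine Finset.prod_congr rfl fun j _ => ?_
    rw [div_eq_mul_one_div, mul_pow, pow_mul]
  have hp0 : 0 < pExp n := lt_of_lt_of_le k.succ_pos (le_pExp n)
  have hG : Real.Gamma (pExp n) ≠ 0 := (Real.Gamma_pos_of_pos (by exact_mod_cast hp0)).ne'
  have hGk : Real.Gamma ((k + 1 : ℕ) : ℝ) = (k ! : ℝ) := by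
    push_cast; exact Real.Gamma_nat_eq_factorial k
  have hf : (∏ j, ((n j)! : ℝ)) ≠ 0 :=
    Finset.prod_ne_zero_iff.2 fun j _ => by exact_mod_cast (n j).factorial_ne_zero
  have hk : (k ! : ℝ) ≠ 0 := by exact_mod_cast k.factorial_ne_zero
  have hpow : (L * b / y) ^ pExp n = (L : ℝ) ^ pExp n * ((b / y) ^ k * (b / y) *
      (b / y) ^ (∑ j : Fin (k + 1), (j : ℕ) * n j)) := by
    rw [mul_div_assoc, mul_pow, ← pow_succ, ← pow_add, pExp]
  rw [hprod, maxWeight, invGammaPDFReal_natCast _ _ hy, coefB, hexp, hGk, hLf, hmult, hpow]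
  field_simp

/-- The law of the largest of `L` independent inverse gamma variables with shape `α`. -/
noncomputable def maxInvGamma (α L : ℕ) (b : ℝ) : Measure ℝ :=
  ∑ n ∈ multiIndices α L, ENNReal.ofReal (maxWeight L n) • invGammaMeasure (pExp n) (L * b)

theorem invGammaMeasure_Iic_of_nonpos (p b : ℝ) {x : ℝ} (hx : x ≤ 0) :
    invGammaMeasure p b (Iic x) = 0 :=
  measure_mono_null (fun _ hy => not_lt.2 (le_trans hy hx)) (ae_iff.1 (ae_pos_invGammaMeasure p b))

theorem maxInvGamma_Iic {L : ℕ} (hL : L ≠ 0) (k : ℕ) {b : ℝ} (hb : 0 < b) {x : ℝ} (hx : 0 < x) :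
    maxInvGamma (k + 1) L b (Iic x) = ENNReal.ofReal (erlangTail (k + 1) (b / x) ^ L) := by
  have hLb : 0 < (L : ℝ) * b := mul_pos (by exact_mod_cast Nat.pos_of_ne_zero hL) hb
  have hp : ∀ n : Fin (k + 1) → ℕ, (0 : ℝ) < pExp n := fun n => by
    exact_mod_cast lt_of_lt_of_le k.succ_pos (le_pExp n)
  have h := withDensity_ofReal_sum_mul (multiIndices (k + 1) L)
    (w := fun n => maxWeight L n) (g := fun n => invGammaPDFReal (pExp n) (L * b))
    (fun n _ => maxWeight_nonneg L n) (fun n _ => measurable_invGammaPDFReal _ _)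
    (fun n _ => invGammaPDFReal_nonneg (hp n) hLb)
  rw [maxInvGamma]
  simp only [invGammaMeasure]
  rw [← h]
  refine withDensity_Iic_eq_of_hasDerivAt (G := fun y => erlangTail (k + 1) (b / y) ^ L)
    ?_ ?_ ?_ ?_ (tendsto_erlangTail_div_pow _ hL hb) hx
  · exact integrable_finsetSum _ fun n _ => (integrable_invGammaPDFReal (hp n) hLb).const_mul _
  · exact fun y => Finset.sum_nonneg fun n _ =>
      mul_nonneg (maxWeight_nonneg L n) (invGammaPDFReal_nonneg (hp n) hLb y)
  · exact fun y hy => Finset.sum_eq_zero fun n _ => by simp [invGammaPDFReal, not_lt.2 hy]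
  · intro y hy
    rw [sum_maxWeight_mul_invGammaPDFReal hL k b hy]
    exact hasDerivAt_erlangTail_div_pow k L b hy

theorem invGammaMeasure_Iic (k : ℕ) {b : ℝ} (hb : 0 < b) {x : ℝ} (hx : 0 < x) :
    invGammaMeasure (k + 1 : ℕ) b (Iic x) = ENNReal.ofReal (erlangTail (k + 1) (b / x)) := by
  have hp : (0 : ℝ) < (k + 1 : ℕ) := by exact_mod_cast k.succ_pos
  refine withDensity_Iic_eq_of_hasDerivAt (G := fun y => erlangTail (k + 1) (b / y))
    (integrable_invGammaPDFReal hp hb) (invGammaPDFReal_nonneg hp hb)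
    (fun y hy => by simp [invGammaPDFReal, not_lt.2 hy]) (fun y hy => ?_)
    (by simpa using tendsto_erlangTail_div_pow (k + 1) one_ne_zero hb) hx
  have h := hasDerivAt_erlangTail_div_pow k 1 b hy
  simp only [pow_one, Nat.cast_one, one_mul, Nat.sub_self, pow_zero] at h
  convert! h using 1
  rw [invGammaPDFReal_natCast _ _ hy]
  push_cast
  rw [Real.Gamma_nat_eq_factorial]
  have hk : (k ! : ℝ) ≠ 0 := by exact_mod_cast k.factorial_ne_zero
  rw [pow_succ]
  field_simp

theorem map_iSup_eq_maxInvGamma {S : Type*} [MeasurableSpace S] {μ : Measure S}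
    [IsProbabilityMeasure μ] {L : ℕ} (hL : L ≠ 0) (k : ℕ) {b : ℝ} (hb : 0 < b)
    {I : Fin L → S → ℝ} (hImeas : ∀ i, Measurable (I i))
    (hI : ∀ i, HasLaw (I i) (invGammaMeasure (k + 1 : ℕ) b) μ) (hindep : iIndepFun I μ) :
    μ.map (fun ω => ⨆ i, I i ω) = maxInvGamma (k + 1) L b := by
  have : NeZero L := ⟨hL⟩
  have hM : Measurable fun ω => ⨆ i, I i ω := Measurable.iSup hImeas
  have : IsProbabilityMeasure (μ.map fun ω => ⨆ i, I i ω) :=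
    Measure.isProbabilityMeasure_map hM.aemeasurable
  refine Measure.ext_of_Iic _ _ fun x => ?_
  have hset : (fun ω => ⨆ i, I i ω) ⁻¹' Iic x = ⋂ i, I i ⁻¹' Iic x := by
    ext ω
    simp only [mem_preimage, mem_Iic, mem_iInter]
    exact ciSup_le_iff (finite_range _).bddAbove
  have h1 : μ.map (fun ω => ⨆ i, I i ω) (Iic x) = invGammaMeasure (k + 1 : ℕ) b (Iic x) ^ L := by
    rw [Measure.map_apply hM measurableSet_Iic, hset,
      hindep.meas_iInter fun i => ⟨_, measurableSet_Iic, rfl⟩]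
    have : ∀ i, μ (I i ⁻¹' Iic x) = invGammaMeasure (k + 1 : ℕ) b (Iic x) := fun i => by
      rw [← (hI i).map_eq, Measure.map_apply (hImeas i) measurableSet_Iic]
    simp [this]
  rw [h1]
  rcases le_or_gt x 0 with hx | hx
  · rw [invGammaMeasure_Iic_of_nonpos _ _ hx, zero_pow hL, maxInvGamma, Measure.finsetSum_apply]
    refine (Finset.sum_eq_zero fun n _ => ?_).symm
    rw [Measure.smul_apply, invGammaMeasure_Iic_of_nonpos _ _ hx, smul_zero]
  · rw [invGammaMeasure_Iic k hb hx, maxInvGamma_Iic hL k hb hx, ENNReal.ofReal_pow]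
    unfold erlangTail
    positivity

/-! ### Selection by the largest shadowing -/

/-- By Fubini the diagonal is null for `ρ.prod τ`, as each of its sections is a singleton. -/
theorem ae_ne_of_indepFun {S : Type*} [MeasurableSpace S] {μ : Measure S} [IsProbabilityMeasure μ]
    {X Y : S → ℝ} {ρ τ : Measure ℝ} [NullSingletonClass τ] (hX : HasLaw X ρ μ) (hY : HasLaw Y τ μ)
    (h : IndepFun X Y μ) : ∀ᵐ ω ∂μ, X ω ≠ Y ω := by
  have := hX.isProbabilityMeasure_iff.1 inferInstance
  have := hY.isProbabilityMeasure_iff.1 inferInstance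
  have hXY := h.hasLaw_prod hX hY
  have hd : MeasurableSet {z : ℝ × ℝ | z.1 ≠ z.2} :=
    (measurableSet_eq_fun measurable_fst measurable_snd).compl
  have hprod : ∀ᵐ z ∂(ρ.prod τ), z.1 ≠ z.2 := by
    rw [Measure.ae_prod_iff_ae_ae hd]
    refine Eventually.of_forall fun x => ?_
    have : {y | ¬ x ≠ y} = {x} := by ext y; simp [eq_comm]
    rw [ae_iff, this, measure_singleton]
  rw [← hXY.map_eq] at hprod
  exact ae_of_ae_map hXY.aemeasurable hprod

/-- The variable selected by the largest `I i`, times that largest value, where the selection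
is independent of the variables selected from. -/
theorem hasLaw_selected_mul_iSup {S : Type*} [MeasurableSpace S] {μ : Measure S}
    [IsProbabilityMeasure μ] {L : ℕ} [NeZero L] {X I : Fin L → S → ℝ} {ξ : Measure ℝ}
    (hX : ∀ i, HasLaw (X i) ξ μ) (hXmeas : ∀ i, Measurable (X i))
    (hImeas : ∀ i, Measurable (I i))
    (hindep : ∀ i, IndepFun (X i) (fun ω j => I j ω) μ)
    (hties : ∀ᵐ ω ∂μ, ∀ i j, i ≠ j → I i ω ≠ I j ω)
    {s : S → Fin L} (hsmeas : Measurable s) (hs : ∀ ω i, I i ω ≤ I (s ω) ω) :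
    HasLaw (fun ω => X (s ω) ω * ⨆ i, I i ω) (ξ ∗ₘ μ.map fun ω => ⨆ i, I i ω) μ := by
  have := (hX 0).isProbabilityMeasure_iff.1 inferInstance
  have hM : Measurable fun ω => ⨆ i, I i ω := Measurable.iSup hImeas
  have hV : Measurable fun ω => fun j => I j ω := measurable_pi_lambda _ hImeas
  have hsup : Measurable fun v : Fin L → ℝ => ⨆ i, v i :=
    Measurable.iSup fun i => measurable_pi_apply i
  have hXs : Measurable fun ω => X (s ω) ω :=
    (measurable_from_prod_countable_right (f := fun z : Fin L × S => X z.1 z.2) hXmeas).comp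
      (hsmeas.prodMk measurable_id)
  have : IsProbabilityMeasure (μ.map fun ω => ⨆ i, I i ω) :=
    Measure.isProbabilityMeasure_map hM.aemeasurable
  have hout : Measurable fun ω => X (s ω) ω * ⨆ i, I i ω := hXs.mul hM
  refine ⟨hout.aemeasurable, ?_⟩
  -- `A i` is the event that coordinate `i` is maximal. Off ties exactly one of these occurs, namely
  -- that of `s ω`, so summing over `i` realises the selection.
  let A : Fin L → Set (Fin L → ℝ) := fun i => {v | ∀ j, v j ≤ v i}
  have hA : ∀ i, MeasurableSet (A i) := fun i => by
    have : A i = ⋂ j, {v : Fin L → ℝ | v j ≤ v i} := by ext v; simp [A]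
    rw [this]
    exact MeasurableSet.iInter fun j =>
      measurableSet_le (measurable_pi_apply j) (measurable_pi_apply i)
  have hselect : ∀ᵐ ω ∂μ, ∀ c : Fin L → ENNReal,
      ∑ i, (A i).indicator (fun _ => c i) (fun j => I j ω) = c (s ω) := by
    filter_upwards [hties] with ω hω c
    rw [Finset.sum_eq_single (s ω)]
    · exact indicator_of_mem (show _ ∈ A (s ω) from hs ω) _
    · intro i _ hi
      refine indicator_of_notMem (fun h => hω i (s ω) hi ?_) _
      exact le_antisymm (hs ω i) (h (s ω))
    · simp
  ext B hB
  have hg : Measurable (B.indicator (1 : ℝ → ENNReal)) := measurable_one.indicator hB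
  set g := B.indicator (1 : ℝ → ENNReal) with hgdef
  let h : (Fin L → ℝ) → ENNReal := fun v => ∫⁻ x, g (x * ⨆ i, v i) ∂ξ
  have hh : Measurable h :=
    Measurable.lintegral_prod_right' (f := fun z : (Fin L → ℝ) × ℝ => g (z.2 * ⨆ i, z.1 i))
      (by fun_prop)
  -- With `i` fixed, `X i` is independent of the whole vector of shadowings and can be integrated
  -- out; the resulting `h` no longer depends on `i`.
  have hterm : ∀ i, ∫⁻ ω, (A i).indicator (fun v => g (X i ω * ⨆ j, v j)) (fun j => I j ω) ∂μ =
      ∫⁻ ω, (A i).indicator h (fun j => I j ω) ∂μ := fun i => by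
    have hlaw := (hindep i).symm.hasLaw_prod
      (HasLaw.mk (μ := μ.map fun ω j => I j ω) hV.aemeasurable rfl) (hX i)
    have hmeas : Measurable fun z : (Fin L → ℝ) × ℝ =>
        (Prod.fst ⁻¹' A i).indicator (fun z => g (z.2 * ⨆ j, z.1 j)) z :=
      Measurable.indicator (by fun_prop) (measurable_fst (hA i))
    have := Measure.isProbabilityMeasure_map (μ := μ) hV.aemeasurable
    have e := hlaw.lintegral_comp hmeas.aemeasurable
    rw [lintegral_prod _ hmeas.aemeasurable] at e
    rw [← lintegral_map (hh.indicator (hA i)) hV]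
    refine Eq.trans ?_ (e.trans ?_)
    · rfl
    · refine lintegral_congr fun v => ?_
      by_cases hv : v ∈ A i
      · simp [indicator, hv, h]
      · simp [indicator, hv]
  have hmeas1 : ∀ i, Measurable fun ω =>
      (A i).indicator (fun v => g (X i ω * ⨆ j, v j)) (fun j => I j ω) := fun i => by
    have : (fun ω => (A i).indicator (fun v => g (X i ω * ⨆ j, v j)) (fun j => I j ω)) =
        ((fun ω j => I j ω) ⁻¹' A i).indicator fun ω => g (X i ω * ⨆ j, I j ω) := by
      funext ω
      simp [indicator]
    rw [this]
    exact Measurable.indicator (hg.comp ((hXmeas i).mul hM)) (hV (hA i))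
  rw [Measure.mconv_comm, ← lintegral_indicator_one hB, ← lintegral_indicator_one hB, ← hgdef,
    lintegral_map hg hout, Measure.lintegral_mconv hg, lintegral_map (by
      exact Measurable.lintegral_prod_right' (f := fun z : ℝ × ℝ => g (z.1 * z.2)) (by fun_prop)) hM]
  calc ∫⁻ ω, g (X (s ω) ω * ⨆ i, I i ω) ∂μ
      = ∫⁻ ω, ∑ i, (A i).indicator (fun v => g (X i ω * ⨆ j, v j)) (fun j => I j ω) ∂μ := by
        refine lintegral_congr_ae (hselect.mono fun ω hω => ?_)
        simpa [indicator] using (hω fun i => g (X i ω * ⨆ j, I j ω)).symm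
    _ = ∑ i, ∫⁻ ω, (A i).indicator h (fun j => I j ω) ∂μ := by
        rw [lintegral_finsetSum _ fun i _ => hmeas1 i]
        exact Finset.sum_congr rfl fun i _ => hterm i
    _ = ∫⁻ ω, ∑ i, (A i).indicator h (fun j => I j ω) ∂μ :=
        (lintegral_finsetSum _ fun i _ => (hh.indicator (hA i)).comp hV).symm
    _ = ∫⁻ ω, h (fun j => I j ω) ∂μ := by
        refine lintegral_congr_ae (hselect.mono fun ω hω => ?_)
        exact hω fun _ => h fun j => I j ω
    _ = ∫⁻ ω, ∫⁻ x, g ((⨆ i, I i ω) * x) ∂ξ ∂μ := by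
        simp only [h, mul_comm]

theorem mconv_sum_smul {ι : Type*} (t : Finset ι) (c : ι → ENNReal) (ρ : Measure ℝ) [SFinite ρ]
    (τ : ι → Measure ℝ) [∀ i, SFinite (τ i)] [SFinite (∑ i ∈ t, c i • τ i)] :
    ρ ∗ₘ (∑ i ∈ t, c i • τ i) = ∑ i ∈ t, c i • (ρ ∗ₘ τ i) := by
  rw [Measure.mconv_comm]
  simp_rw [Measure.mconv_comm ρ]
  ext A hA
  have hg : Measurable (A.indicator (1 : ℝ → ENNReal)) := measurable_one.indicator hA
  rw [← lintegral_indicator_one hA, ← lintegral_indicator_one hA, Measure.lintegral_mconv hg,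
    lintegral_finsetSum_measure, lintegral_finsetSum_measure]
  refine Finset.sum_congr rfl fun i _ => ?_
  rw [lintegral_smul_measure, lintegral_smul_measure, Measure.lintegral_mconv hg]

theorem indepFun_sq_mul_sq {S : Type*} [MeasurableSpace S] {μ : Measure S} {L : ℕ}
    {N : Fin 2 → S → ℝ} {I : Fin L → S → ℝ} (hN : ∀ j, Measurable (N j))
    (hI : ∀ i, Measurable (I i))
    (h : iIndepFun (Sum.elim N I : Fin 2 ⊕ Fin L → S → ℝ) μ) :
    IndepFun (fun ω => N 0 ω ^ 2 * N 1 ω ^ 2) (fun ω j => I j ω) μ := by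
  classical
  have hmeas : ∀ k, Measurable ((Sum.elim N I : Fin 2 ⊕ Fin L → S → ℝ) k) := by
    rintro (j | j)
    · exact hN j
    · exact hI j
  have hd : Disjoint (Finset.univ.map (Function.Embedding.inl : Fin 2 ↪ Fin 2 ⊕ Fin L))
      (Finset.univ.map (Function.Embedding.inr : Fin L ↪ Fin 2 ⊕ Fin L)) := by
    rw [Finset.disjoint_left]
    simp
  have h1 := h.indepFun_finset _ _ hd hmeas
  have m1 : Measurable fun v : (Finset.univ.map
      (Function.Embedding.inl : Fin 2 ↪ Fin 2 ⊕ Fin L)) → ℝ =>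
      v ⟨Sum.inl 0, by simp⟩ ^ 2 * v ⟨Sum.inl 1, by simp⟩ ^ 2 := by fun_prop
  have m2 : Measurable fun (v : (Finset.univ.map
      (Function.Embedding.inr : Fin L ↪ Fin 2 ⊕ Fin L)) → ℝ) (j : Fin L) =>
      v ⟨Sum.inr j, by simp⟩ := by fun_prop
  exact h1.comp m1 m2

theorem hasLaw_sq_mul_sq {S : Type*} [MeasurableSpace S] {μ : Measure S}
    [IsProbabilityMeasure μ] {L : ℕ} {N : Fin 2 → S → ℝ} {I : Fin L → S → ℝ}
    {ρ : Fin 2 → Measure ℝ}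
    (hN : ∀ j, HasLaw (fun ω => N j ω ^ 2) (ρ j) μ)
    (h : iIndepFun (Sum.elim N I : Fin 2 ⊕ Fin L → S → ℝ) μ) :
    HasLaw (fun ω => N 0 ω ^ 2 * N 1 ω ^ 2) (ρ 0 ∗ₘ ρ 1) μ := by
  have := (hN 0).isProbabilityMeasure_iff.1 inferInstance
  have := (hN 1).isProbabilityMeasure_iff.1 inferInstance
  have h01 : IndepFun (N 0) (N 1) μ :=
    h.indepFun (i := Sum.inl 0) (j := Sum.inl 1) (by simp)
  have hsq : Measurable fun x : ℝ => x ^ 2 := by fun_prop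
  exact (h01.comp hsq hsq).hasLaw_fun_mul (hN 0) (hN 1)

theorem hasLaw_outputSNR {S : Type*} [MeasurableSpace S] {μ : Measure S} [IsProbabilityMeasure μ]
    {L : ℕ} (hL : L ≠ 0) (k : ℕ) {m : Fin 2 → ℝ} (hm : ∀ j, 0 < m j) {r : Fin 2 → ℝ}
    (hr : ∀ j, 0 < r j) {b : ℝ} (hb : 0 < b) {N : Fin L → Fin 2 → S → ℝ} {I : Fin L → S → ℝ}
    (hNmeas : ∀ i j, Measurable (N i j)) (hImeas : ∀ i, Measurable (I i))
    (hN : ∀ i j, HasLaw (fun ω => N i j ω ^ 2) (gammaMeasure (m j) (r j)) μ)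
    (hI : ∀ i, HasLaw (I i) (invGammaMeasure (k + 1 : ℕ) b) μ)
    (hindep : ∀ i, iIndepFun (Sum.elim (N i) I : Fin 2 ⊕ Fin L → S → ℝ) μ)
    {s : S → Fin L} (hsmeas : Measurable s) (hs : ∀ ω i, I i ω ≤ I (s ω) ω) :
    HasLaw (outputSNR N I s) (∑ n ∈ multiIndices (k + 1) L, ENNReal.ofReal (maxWeight L n) •
      gammaGammaInvGamma (m 0) (r 0) (m 1) (r 1) (pExp n) (L * b)) μ := by
  have : NeZero L := ⟨hL⟩
  have hLb : 0 < (L : ℝ) * b := mul_pos (by exact_mod_cast Nat.pos_of_ne_zero hL) hb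
  have hp : ∀ n : Fin (k + 1) → ℕ, (0 : ℝ) < pExp n := fun n => by
    exact_mod_cast lt_of_lt_of_le k.succ_pos (le_pExp n)
  have := isProbabilityMeasure_gammaMeasure (hm 0) (hr 0)
  have := isProbabilityMeasure_gammaMeasure (hm 1) (hr 1)
  have hprob : ∀ n : Fin (k + 1) → ℕ, IsProbabilityMeasure (invGammaMeasure (pExp n) (L * b)) :=
    fun n => isProbabilityMeasure_invGammaMeasure (hp n) hLb
  have hIindep : iIndepFun I μ := (hindep 0).precomp (g := Sum.inr) Sum.inr_injective
  have : NullSingletonClass (invGammaMeasure (k + 1 : ℕ) b) :=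
    ⟨fun _ => withDensity_absolutelyContinuous _ _ Real.volume_singleton⟩
  have hties : ∀ᵐ ω ∂μ, ∀ i j, i ≠ j → I i ω ≠ I j ω := by
    refine ae_all_iff.2 fun i => ae_all_iff.2 fun j => ?_
    by_cases hij : i = j
    · exact Eventually.of_forall fun ω h => absurd hij h
    · exact (ae_ne_of_indepFun (hI i) (hI j) (hIindep.indepFun hij)).mono fun ω h _ => h
  have hM : Measurable fun ω => ⨆ i, I i ω := Measurable.iSup hImeas
  have hlaw := hasLaw_selected_mul_iSup (X := fun i ω => N i 0 ω ^ 2 * N i 1 ω ^ 2)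
    (fun i => hasLaw_sq_mul_sq (hN i) (hindep i))
    (fun i => ((hNmeas i 0).pow_const 2).mul ((hNmeas i 1).pow_const 2)) hImeas
    (fun i => indepFun_sq_mul_sq (hNmeas i) hImeas (hindep i)) hties hsmeas hs
  have hmax := map_iSup_eq_maxInvGamma hL k hb hImeas hI hIindep
  have hfin : IsFiniteMeasure (maxInvGamma (k + 1) L b) := by
    rw [← hmax]; infer_instance
  have hout : outputSNR N I s =
      fun ω => N (s ω) 0 ω ^ 2 * N (s ω) 1 ω ^ 2 * ⨆ i, I i ω := by
    funext ω
    rw [outputSNR, mul_pow]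
  rw [hout]
  convert! hlaw using 1
  rw [hmax]
  have hfin' : IsFiniteMeasure (∑ n ∈ multiIndices (k + 1) L,
    ENNReal.ofReal (maxWeight L n) • invGammaMeasure (pExp n) (L * b)) := hfin
  rw [maxInvGamma, mconv_sum_smul]
  refine Finset.sum_congr rfl fun n _ => ?_
  rw [gammaGammaInvGamma, Measure.mconv_assoc]

/-! ### The law of the output SNR -/

theorem mainTheorem9
    {S : Type*} [MeasurableSpace S] (μ : Measure S) [IsProbabilityMeasure μ]
    (L : ℕ) (hL : 1 ≤ L) (α : ℕ) (hα : 1 < α)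
    (m : Fin 2 → ℝ) (hm : ∀ j, 0 < m j)
    (Ω : ℝ) (hΩ : 0 < Ω) (β : ℝ) (hβ : 0 < β)
    (N : Fin L → Fin 2 → S → ℝ) (I : Fin L → S → ℝ)
    (hNmeas : ∀ i j, Measurable (N i j)) (hImeas : ∀ i, Measurable (I i))
    (hN : ∀ i j, HasLaw (fun ω => N i j ω ^ 2) (gammaMeasure (m j) (m j / Ω)) μ)
    (hI : ∀ i, HasLaw (I i) (invGammaMeasure α β) μ)
    (hindep : ∀ i, iIndepFun (Sum.elim (N i) I : Fin 2 ⊕ Fin L → S → ℝ) μ)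
    (s : S → Fin L) (hsmeas : Measurable s) (hs : ∀ ω i, I i ω ≤ I (s ω) ω)
    (gbar gtilde : ℝ) (hgbar : gbar = Ω ^ 2 * β) (hgtilde : gtilde = m 0 * m 1 / gbar) :
    (∃ f : ℝ → ℝ, Measurable f ∧ (∀ x, 0 ≤ f x) ∧ (∀ x ≤ 0, f x = 0) ∧
      HasLaw (outputSNR N I s) (volume.withDensity fun x => ENNReal.ofReal (f x)) μ ∧
      (∀ x > 0, (f x : ℂ) = (coefS (m 0) (m 1) α : ℂ) / (x : ℂ) *
        ∑ n ∈ multiIndices α L, (coefB L n : ℂ) *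
          meijerG 2 1 ![1 - (pExp n : ℂ)] ![(m 0 : ℂ), (m 1 : ℂ)] ((gtilde * x / L : ℝ) : ℂ)) ∧
      IntegrableOn (fun x => x * f x) (Set.Ioi 0) ∧
      ∫ x in Set.Ioi (0 : ℝ), x * f x =
        L * gbar / Real.Gamma α *
          ∑ n ∈ multiIndices α L, coefB L n * Real.Gamma ((pExp n : ℝ) - 1)) ∧
    (∀ x > 0, ((μ.real {ω | outputSNR N I s ω ≤ x} : ℝ) : ℂ) =
      (coefS (m 0) (m 1) α : ℂ) *
        ∑ n ∈ multiIndices α L, (coefB L n : ℂ) *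
          meijerG 2 2 ![1, 1 - (pExp n : ℂ)] ![(m 0 : ℂ), (m 1 : ℂ), 0]
            ((gtilde * x / L : ℝ) : ℂ)) ∧
    (Integrable (outputSNR N I s) μ ∧
      ∫ ω, outputSNR N I s ω ∂μ =
        L * gbar / Real.Gamma α *
          ∑ n ∈ multiIndices α L, coefB L n * Real.Gamma ((pExp n : ℝ) - 1)) := by
  obtain ⟨k, rfl⟩ : ∃ k, α = k + 1 := ⟨α - 1, by omega⟩
  have hL0 : L ≠ 0 := by omega
  have hLpos : (0 : ℝ) < L := by exact_mod_cast hL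
  have hLβ : 0 < (L : ℝ) * β := mul_pos hLpos hβ
  have hr : ∀ j, 0 < m j / Ω := fun j => div_pos (hm j) hΩ
  -- The bound `p(n) ≥ α > 1` makes the first moment of every component finite.
  have hp1 : ∀ n : Fin (k + 1) → ℕ, (1 : ℝ) < pExp n := fun n => by
    exact_mod_cast lt_of_lt_of_le hα (le_pExp n)
  have hp : ∀ n : Fin (k + 1) → ℕ, (0 : ℝ) < pExp n := fun n => zero_lt_one.trans (hp1 n)
  have hΓ : ∀ n : Fin (k + 1) → ℕ, Real.Gamma (pExp n) ≠ 0 := fun n =>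
    (Real.Gamma_pos_of_pos (hp n)).ne'
  have hlaw := hasLaw_outputSNR (r := fun j => m j / Ω) hL0 k hm hr hβ hNmeas hImeas hN hI
    hindep hsmeas hs
  set ρ : (Fin (k + 1) → ℕ) → Measure ℝ := fun n =>
    gammaGammaInvGamma (m 0) (m 0 / Ω) (m 1) (m 1 / Ω) (pExp n) (L * β) with hρ
  have hρprob : ∀ n, IsProbabilityMeasure (ρ n) := fun n =>
    isProbabilityMeasure_gammaGammaInvGamma (hm 0) (hr 0) (hm 1) (hr 1) (hp n) hLβ
  set g : (Fin (k + 1) → ℕ) → ℝ → ℝ := fun n =>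
    gammaGammaInvGammaPDF (m 0) (m 0 / Ω) (m 1) (m 1 / Ω) (pExp n) (L * β) with hg
  have hgmeas : ∀ n, Measurable (g n) := fun n =>
    measurable_gammaGammaInvGammaPDF (hm 1) (hr 1) (hp n) hLβ
  have hg0 : ∀ n x, 0 ≤ g n x := fun n =>
    gammaGammaInvGammaPDF_nonneg (hm 0) (hr 0) (hm 1) (hr 1) (hp n) hLβ
  have hρg : ∀ n, ρ n = volume.withDensity fun x => ENNReal.ofReal (g n x) := fun n =>
    gammaGammaInvGamma_eq_withDensity (hm 0) (hr 0) (hm 1) (hr 1) (hp n) hLβ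
  set f : ℝ → ℝ := fun x => ∑ n ∈ multiIndices (k + 1) L, maxWeight L n * g n x with hf
  have hfmeas : Measurable f := by fun_prop
  have hf0 : ∀ x, 0 ≤ f x := fun x =>
    Finset.sum_nonneg fun n _ => mul_nonneg (maxWeight_nonneg L n) (hg0 n x)
  have hνf : ∑ n ∈ multiIndices (k + 1) L, ENNReal.ofReal (maxWeight L n) • ρ n =
      volume.withDensity fun x => ENNReal.ofReal (f x) := by
    rw [hf, withDensity_ofReal_sum_mul _ (fun n _ => maxWeight_nonneg L n) (fun n _ => hgmeas n)
      (fun n _ => hg0 n)]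
    simp_rw [hρg]
  have hmoment : ∀ n, Integrable (fun x : ℝ => x) (ρ n) ∧ ∫ x, x ∂(ρ n) =
      Ω ^ 2 * (L * β) * Real.Gamma (pExp n - 1) / Real.Gamma (pExp n) := fun n => by
    obtain ⟨h1, h2⟩ := integrable_and_integral_gammaGammaInvGamma (hm 0) (hr 0) (hm 1) (hr 1)
      (hp n) hLβ (hp1 n)
    refine ⟨h1, h2.trans ?_⟩
    have := (hm 0).ne'
    have := (hm 1).ne'
    field_simp
  have hint : Integrable (fun x : ℝ => x)
      (∑ n ∈ multiIndices (k + 1) L, ENNReal.ofReal (maxWeight L n) • ρ n) :=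
    integrable_finsetSum_measure.2 fun n _ => (hmoment n).1.smul_measure ENNReal.ofReal_ne_top
  have hmean : ∫ x, x ∂(∑ n ∈ multiIndices (k + 1) L, ENNReal.ofReal (maxWeight L n) • ρ n) =
      L * gbar / Real.Gamma (k + 1 : ℕ) *
        ∑ n ∈ multiIndices (k + 1) L, coefB L n * Real.Gamma ((pExp n : ℝ) - 1) := by
    rw [integral_finsetSum_measure fun n _ => (hmoment n).1.smul_measure ENNReal.ofReal_ne_top,
      Finset.mul_sum]
    refine Finset.sum_congr rfl fun n _ => ?_
    rw [integral_smul_measure, (hmoment n).2, ENNReal.toReal_ofReal (maxWeight_nonneg L n),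
      smul_eq_mul, maxWeight, hgbar]
    have := hΓ n
    field_simp
  -- The scale `L β` of the components is the source of the division by `L` in the Meijer argument.
  have hz : ∀ x : ℝ, m 0 / Ω * (m 1 / Ω) / (L * β) * x = gtilde * x / L := fun x => by
    rw [hgtilde, hgbar]
    field_simp
  have hΓC : ∀ n : Fin (k + 1) → ℕ,
      ((Real.Gamma (pExp n) : ℝ) : ℂ) = Complex.Gamma (pExp n) := fun n => by
    rw [← Complex.Gamma_ofReal, Complex.ofReal_natCast]
  have hΓC0 : ∀ n : Fin (k + 1) → ℕ, Complex.Gamma (pExp n) ≠ 0 := fun n => by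
    rw [← hΓC]
    exact_mod_cast hΓ n
  have hfneg : ∀ x ≤ 0, f x = 0 := fun x hx => by
    refine Finset.sum_eq_zero fun n _ => ?_
    simp [hg, gammaGammaInvGammaPDF, gammaMixPDF, not_lt.2 hx]
  refine ⟨⟨f, hfmeas, hf0, hfneg, hνf ▸ hlaw, ?_, ?_⟩, ?_, ?_⟩
  · intro x hx
    rw [hf]
    push_cast
    rw [Finset.mul_sum]
    refine Finset.sum_congr rfl fun n _ => ?_
    have h := gammaGammaInvGammaPDF_eq_meijerG (hm 0) (hr 0) (hm 1) (hr 1) (hp n) hLβ hx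
    simp only [hz, Complex.Gamma_ofReal, Complex.ofReal_natCast] at h
    rw [hg]
    simp only
    rw [h, maxWeight, coefS]
    have := hΓC0 n
    push_cast
    rw [hΓC]
    field_simp
  · have hlt : ∀ᵐ x ∂(volume : Measure ℝ), ENNReal.ofReal (f x) < ⊤ := by simp
    have hcompl : ∀ x, x ∉ Ioi (0 : ℝ) → x * f x = 0 := fun x hx => by
      rw [hfneg x (not_lt.1 fun h => hx h), mul_zero]
    have e : (fun x => (ENNReal.ofReal (f x)).toReal • x) = fun x => x * f x := by
      funext x
      rw [ENNReal.toReal_ofReal (hf0 x), smul_eq_mul, mul_comm]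
    constructor
    · rw [hνf, integrable_withDensity_iff_integrable_smul' hfmeas.ennreal_ofReal hlt, e] at hint
      exact hint.integrableOn
    · rw [setIntegral_eq_integral_of_forall_compl_eq_zero hcompl, ← hmean, hνf,
        integral_withDensity_eq_integral_toReal_smul hfmeas.ennreal_ofReal hlt, e]
  · intro x hx
    have h1 : μ.real {ω | outputSNR N I s ω ≤ x} =
        ∑ n ∈ multiIndices (k + 1) L, maxWeight L n * (ρ n).real (Iic x) := by
      rw [hlaw.measureReal_eq (p := fun y => y ≤ x) measurableSet_Iic, measureReal_def,
        Measure.finsetSum_apply, ENNReal.toReal_sum]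
      · refine Finset.sum_congr rfl fun n _ => ?_
        rw [Measure.smul_apply, smul_eq_mul, ENNReal.toReal_mul,
          ENNReal.toReal_ofReal (maxWeight_nonneg L n)]
        rfl
      · exact fun n _ => ENNReal.mul_ne_top ENNReal.ofReal_ne_top (measure_ne_top _ _)
    rw [h1]
    push_cast
    rw [Finset.mul_sum]
    refine Finset.sum_congr rfl fun n _ => ?_
    have h := gammaGammaInvGamma_real_Iic_eq_meijerG (hm 0) (hr 0) (hm 1) (hr 1) (hp n) hLβ hx
    simp only [hz, Complex.Gamma_ofReal, Complex.ofReal_natCast] at h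
    rw [h, maxWeight, coefS]
    have := hΓC0 n
    push_cast
    rw [hΓC]
    field_simp
  · constructor
    · have := hint
      rw [← hlaw.map_eq] at this
      exact this.comp_aemeasurable hlaw.aemeasurable
    · rw [hlaw.integral_eq, hmean]
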